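/- Let $n\ge 4$, let $W=\mathbb{C}^n$ be the natural permutation representation of $S_n$ with standard basis $y_1,\dots,y_n$, let $x_1,\dots,x_n$ be the dual basis of $W^*$, and let $S_n$ act on $V=W^*\oplus W$ by the doubled permutation representation, ${}^{\sigma}x_i=x_{\sigma(i)}$, ${}^{\sigma}y_i=y_{\sigma(i)}$. Put $x_{[n]}=\sum_i x_i$, $y_{[n]}=\sum_i y_i$. **Definitions.** For a finite group $G$ acting linearly on a complex vector space $V$, a linear (resp. constant) $2$-cochain is a family $\alpha=\sum_{g\in G}\alpha_g g$ of alternating bilinear maps $\alpha_g$ on $V$ with values in $V$ (resp. $\mathbb{C}$). It is $G$-invariant if ${}^h(\alpha_g(v,w))=\alpha_{hgh^{-1}}({}^hv,{}^hw)$ for all $g,h,v,w$. For a linear or constant $2$-cochain $\alpha$ and a linear $2$-cochain $\beta$ let $$\psi(\alpha)_g(v_1,v_2,v_3)=\alpha_g(v_1,v_2)({}^gv_3-v_3)+\alpha_g(v_2,v_3)({}^gv_1-v_1)+\alpha_g(v_3,v_1)({}^gv_2-v_2)\in S(V),$$ $$\phi(\alpha,\beta)_g(v_1,v_2,v_3)=\sum_{xy=g}\bigl[\alpha_x(v_1+{}^yv_1,\beta_y(v_2,v_3))+\alpha_x(v_2+{}^yv_2,\beta_y(v_3,v_1))+\alpha_x(v_3+{}^yv_3,\beta_y(v_1,v_2))\bigr].$$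 A sum $\kappa=\kappa^L+\kappa^C$ of a linear and a constant $2$-cochain is a Drinfeld orbifold algebra map if $\operatorname{im}\kappa^L_g\subseteq V^g$ for all $g$, $\kappa^L$ and $\kappa^C$ are $G$-invariant, $\psi(\kappa^L)=0$, $\phi(\kappa^L,\kappa^L)=2\psi(\kappa^C)$ and $\phi(\kappa^C,\kappa^L)=0$. It is a Lie orbifold algebra map if moreover $\kappa^L_g=0$ for all $g\ne1$. For complex parameters $a_1,\dots,a_7,b_1,\dots,b_7,\alpha,\beta,c$, let $\kappa^L_1$ and $\kappa^C_1$ be the cochains supported only on the identity with, for $i\neq j$, $$\kappa^L_1(x_i,x_j)=a_1(x_i-x_j)+b_1(y_i-y_j),\qquad \kappa^L_1(y_i,y_j)=a_2(x_i-x_j)+b_2(y_i-y_j),$$ $$\kappa^L_1(x_i,y_i)=a_3x_i+a_4x_{[n]}+b_3y_i+b_4y_{[n]},\qquad \kappa^L_1(x_i,y_j)=a_5x_i+a_6x_j+a_7x_{[n]}+b_5y_i+b_6y_j+b_7y_{[n]},$$ $$\kappa^C_1(x_i,x_j)=\kappa^C_1(y_i,y_j)=0,\qquad \kappa^C_1(x_i,y_i)=\alpha,\qquad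 \kappa^C_1(x_i,y_j)=\beta,$$ and let $\kappa^C_{\mathrm{ref}}$ be the constant cochain supported only on transpositions such that, for a transposition $g$ and an index $i$ moved by $g$, $\kappa^C_g(x_i,y_i)=-\kappa^C_g(x_i,y_{g(i)})=c$, all other values $\kappa^C_g(x_k,y_l)$ and all values $\kappa^C_g(x_k,x_l)$, $\kappa^C_g(y_k,y_l)$ being $0$. **Conditions (I).** $$\begin{aligned} &a_1(a_5+a_6+na_7)-b_1a_2-b_5a_6+a_5(b_5+b_6+nb_7)+b_7(a_3-a_5-a_6)=0\\ &b_1(a_5+a_6+na_7)-b_1b_2+b_1a_5+b_5(b_5-a_1+nb_7)+b_7(b_3-b_5-b_6)=0\\ &-a_2(b_5+b_6+nb_7)-a_2a_1-a_2b_6+a_6(a_6+b_2+na_7)+a_7(a_3-a_5-a_6)=0\\ &-b_2(b_5+b_6+nb_7)-a_2b_1-a_6b_5+b_6(a_5+a_6+na_7)+a_7(b_3-b_5-b_6)=0\\ &a_7(b_3-b_5)-a_4b_6+(b_4-b_7)(a_4+(n-1)a_7+a_6)=0\\ &a_1(a_3+na_4)+a_5(b_3+nb_4)+b_4(a_3-a_5-a_6)-a_2b_1-b_5a_6=0\\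 &-a_1(a_5+a_6+na_7)-a_5(b_5+nb_7)-b_7(a_3-a_5-a_6)+a_2b_1+b_3a_6-a_3b_6=0\\ &b_7(b_3-b_5)-b_4b_6+(b_4-b_7)(a_1+b_4+(n-1)b_7+b_6)-b_1(a_4-a_7)=0\\ &b_1(a_5-b_2+a_3+na_4)-b_5(a_1+b_6-b_3-nb_4)+b_4(b_3-b_5-b_6)=0\\ &b_1(-b_2+a_5+a_3+na_7)+b_5(b_5+nb_7)+b_7(b_3-b_5-b_6)-a_1(b_3-b_6)=0\\ &a_7(a_3-a_6)-a_4a_5+(a_4-a_7)(-b_2+a_4+(n-1)a_7+a_5)+a_2(b_4-b_7)=0\\ &-a_2(a_1+b_6+b_3+nb_4)+a_6(b_2-a_5+a_3+na_4)+a_4(a_3-a_5-a_6)=0\\ &a_2(a_1+b_6+b_3+nb_7)-a_6(a_6+na_7)-a_7(a_3-a_5-a_6)-b_2(a_3-a_5)=0\\ &b_7(a_3-a_6)-b_4a_5+(a_4-a_7)(b_4+(n-1)b_7+b_5)=0\\ &-b_2(b_3+nb_4)+b_6(a_3+na_4)+a_4(b_3-b_5-b_6)-a_2b_1-a_6b_5=0\\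 &b_2(b_5+b_6+nb_7)-b_6(a_6+na_7)-a_7(b_3-b_5-b_6)+a_2b_1+a_3b_5-b_3a_5=0 \end{aligned}$$ **Conditions (II).** $$\begin{aligned} &\alpha(a_1-b_6+b_4-b_7)-\beta(a_1-b_3+b_5-(n-1)(b_4-b_7))=0\\ &\alpha(-b_2-a_5+a_4-a_7)+\beta(b_2+a_3-a_6+(n-1)(a_4-a_7))=0 \end{aligned}$$ **Conditions (III).** $c(a_1-b_6)=0$, $\ c(2a_1-b_3+b_5-b_6)=0$, $\ c(a_5+b_2)=0$, $\ c(2b_2+a_3+a_5-a_6)=0$. **Conditions (IV).** $$\begin{aligned} &a_1=b_6,\quad a_1-b_3+b_5=0,\quad b_2=-a_5,\quad b_2+a_3-a_6=0\\ &a_1(a_4-a_7)-(b_4-b_7)(a_6+a_4+(n-1)a_7)=0\\ &b_1(a_4-a_7)-(b_4-b_7)(b_6+b_4+(n-1)b_7)=0\\ &(a_4-a_7)(a_5+a_4+(n-1)a_7)+a_2(b_4-b_7)=0\\ &(a_4-a_7)(b_5+b_4+(n-1)b_7)-a_5(b_4-b_7)=0\\ &a_1(a_3+na_4)+a_5(b_3+nb_4)-b_1a_2-b_5a_6=0\\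 &a_1(a_3+na_7)+a_5(b_3+nb_7)-b_1a_2-b_5a_6=0\\ &b_1(a_3+na_4)+b_5(b_3+nb_4)-2b_1b_2-2b_5b_6=0\\ &b_1(a_3+na_7)+b_5(b_3+nb_7)-2b_1b_2-2b_5b_6=0\\ &-a_2(b_3+nb_4)+a_6(a_3+na_4)-2a_1a_2-2a_5a_6=0\\ &-a_2(b_3+nb_7)+a_6(a_3+na_7)-2a_1a_2-2a_5a_6=0\\ &(\alpha+(n-1)\beta)(b_4-b_7)=0,\quad (\alpha+(n-1)\beta)(a_4-a_7)=0 \end{aligned}$$ **Theorem.** The Lie orbifold algebra maps for $S_n$ acting on $V=W^*\oplus W$ are precisely the maps $\kappa=\kappa^L_1+\kappa^C_1+\kappa^C_{\mathrm{ref}}$ whose parameters satisfy conditions (I), (II) and (III); more precisely, every Lie orbifold algebra map is of this form, and for every choice of the $17$ parameters $\kappa^L_1+\kappa^C_1+\kappa^C_{\mathrm{ref}}$ is a Lie orbifold algebra map if and only if (I), (II) and (III) hold. In particular: 1. $\kappa^L_1+\kappa^C_1$ is a Lie orbifold algebra map if and only if (I) and (II) hold. 2. If $\kappa^C_{\mathrm{ref}}\not\equiv0$,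 then $\kappa^L_1+\kappa^C_1+\kappa^C_{\mathrm{ref}}$ is a Lie orbifold algebra map if and only if (IV) holds. -/

import Mathlib

open scoped BigOperators

noncomputable section

namespace DrinfeldOrbifold

/-! ## Cochains and Drinfeld orbifold algebra maps for a finite group acting on `V` -/

section General

variable {G V : Type*} [Group G] [AddCommGroup V] [Module ℂ V]

/-- A `G`-graded `2`-cochain `∑ α_g g` with components `α_g : ⋀² V → M`: a linear `2`-cochain
for `M = V`, a constant `2`-cochain for `M = ℂ`. -/
abbrev TwoCochain (G V M : Type*) [AddCommGroup V] [Module ℂ V] [AddCommGroup M] [Module ℂ M] :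
    Type _ :=
  G → V [⋀^Fin 2]→ₗ[ℂ] M

/-- `G`-invariance `ʰ(α_g(v, w)) = α_{hgh⁻¹}(ʰv, ʰw)` of a linear `2`-cochain. -/
def IsInvariantLinear (ρ : Representation ℂ G V) (α : TwoCochain G V V) : Prop :=
  ∀ (g h : G) (v w : V), ρ h (α g ![v, w]) = α (h * g * h⁻¹) ![ρ h v, ρ h w]

/-- `G`-invariance of a constant `2`-cochain (`G` acts trivially on `ℂ`). -/
def IsInvariantConst (ρ : Representation ℂ G V) (α : TwoCochain G V ℂ) : Prop :=
  ∀ (g h : G) (v w : V), α g ![v, w] = α (h * g * h⁻¹) ![ρ h v, ρ h w]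

/-- The component `ψ_g` of `ψ(α)` for a linear `2`-cochain `α`; products are taken in `S(V)`. -/
def psiLinear (ρ : Representation ℂ G V) (α : TwoCochain G V V) (g : G) (v₁ v₂ v₃ : V) :
    SymmetricAlgebra ℂ V :=
  SymmetricAlgebra.ι ℂ V (α g ![v₁, v₂]) * SymmetricAlgebra.ι ℂ V (ρ g v₃ - v₃)
    + SymmetricAlgebra.ι ℂ V (α g ![v₂, v₃]) * SymmetricAlgebra.ι ℂ V (ρ g v₁ - v₁)
    + SymmetricAlgebra.ι ℂ V (α g ![v₃, v₁]) * SymmetricAlgebra.ι ℂ V (ρ g v₂ - v₂)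

/-- The component `ψ_g` of `ψ(α)` for a constant `2`-cochain `α`; it takes values in `V`. -/
def psiConst (ρ : Representation ℂ G V) (α : TwoCochain G V ℂ) (g : G) (v₁ v₂ v₃ : V) : V :=
  α g ![v₁, v₂] • (ρ g v₃ - v₃)
    + α g ![v₂, v₃] • (ρ g v₁ - v₁)
    + α g ![v₃, v₁] • (ρ g v₂ - v₂)

/-- The `(x, y)`-component of `φ(α, β)`. -/
def phiPair {M : Type*} [AddCommGroup M] [Module ℂ M] (ρ : Representation ℂ G V)
    (α : TwoCochain G V M) (β : TwoCochain G V V) (x y : G) (v₁ v₂ v₃ : V) : M :=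
  α x ![v₁ + ρ y v₁, β y ![v₂, v₃]]
    + α x ![v₂ + ρ y v₂, β y ![v₃, v₁]]
    + α x ![v₃ + ρ y v₃, β y ![v₁, v₂]]

/-- The `g`-component `∑_{xy = g} φ_{x,y}` of `φ(α, β)`. -/
def phi {M : Type*} [AddCommGroup M] [Module ℂ M] [Fintype G] [DecidableEq G]
    (ρ : Representation ℂ G V) (α : TwoCochain G V M) (β : TwoCochain G V V)
    (g : G) (v₁ v₂ v₃ : V) : M :=
  ∑ p ∈ (Finset.univ : Finset (G × G)).filter (fun p => p.1 * p.2 = g),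
    phiPair ρ α β p.1 p.2 v₁ v₂ v₃

/-- `κ = κL + κC`, with `κL` a linear and `κC` a constant `2`-cochain, is a
Drinfeld orbifold algebra map. -/
structure IsDrinfeldOrbifoldAlgebraMap [Fintype G] [DecidableEq G] (ρ : Representation ℂ G V)
    (κL : TwoCochain G V V) (κC : TwoCochain G V ℂ) : Prop where
  /-- `im κL_g ⊆ V^g` -/
  image_fixed : ∀ (g : G) (v w : V), ρ g (κL g ![v, w]) = κL g ![v, w]
  invariant_linear : IsInvariantLinear ρ κL
  invariant_const : IsInvariantConst ρ κC
  /-- `ψ(κL) = 0` -/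
  mixed_jacobi : ∀ (g : G) (v₁ v₂ v₃ : V), psiLinear ρ κL g v₁ v₂ v₃ = 0
  /-- `φ(κL, κL) = 2 ψ(κC)` -/
  first_obstruction : ∀ (g : G) (v₁ v₂ v₃ : V),
    phi ρ κL κL g v₁ v₂ v₃ = (2 : ℂ) • psiConst ρ κC g v₁ v₂ v₃
  /-- `φ(κC, κL) = 0` -/
  second_obstruction : ∀ (g : G) (v₁ v₂ v₃ : V), phi ρ κC κL g v₁ v₂ v₃ = 0

/-- A Lie orbifold algebra map: a Drinfeld orbifold algebra map whose linear part is supported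
only on the identity. -/
def IsLieOrbifoldAlgebraMap [Fintype G] [DecidableEq G] (ρ : Representation ℂ G V)
    (κL : TwoCochain G V V) (κC : TwoCochain G V ℂ) : Prop :=
  IsDrinfeldOrbifoldAlgebraMap ρ κL κC ∧ ∀ g : G, g ≠ 1 → κL g = 0

end General

/-! ## Alternating bilinear maps given by their values on a basis -/

section Table

variable {ι V M : Type*} [AddCommGroup V] [Module ℂ V] [AddCommGroup M] [Module ℂ M]

/-- The bilinear map with prescribed values `t i j` on pairs of basis vectors. -/
def bilinOfTable (b : Module.Basis ι ℂ V) (t : ι → ι → M) : V →ₗ[ℂ] V →ₗ[ℂ] M :=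
  b.constr ℂ (fun i => b.constr ℂ (t i))

theorem bilinOfTable_basis (b : Module.Basis ι ℂ V) (t : ι → ι → M) (i j : ι) :
    bilinOfTable b t (b i) (b j) = t i j := by
  simp [bilinOfTable, Module.Basis.constr_basis]

theorem bilinOfTable_self (b : Module.Basis ι ℂ V) (t : ι → ι → M)
    (h : ∀ i j, t i j = -t j i) (v : V) : bilinOfTable b t v v = 0 := by
  have hflip : bilinOfTable b t = -(bilinOfTable b t).flip := by
    refine b.ext fun i => b.ext fun j => ?_
    simp only [LinearMap.neg_apply, LinearMap.flip_apply, bilinOfTable_basis]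
    exact h i j
  have hv : bilinOfTable b t v v = -bilinOfTable b t v v := by
    conv_lhs => rw [hflip]
    simp
  have h2 : (2 : ℂ) • bilinOfTable b t v v = 0 := by
    rw [two_smul]
    nth_rewrite 1 [hv]
    exact neg_add_cancel _
  exact (smul_eq_zero_iff_right (two_ne_zero)).mp h2

/-- The alternating bilinear map with prescribed (skew-symmetric) values `t i j` on pairs of basis
vectors. -/
def altOfTable (b : Module.Basis ι ℂ V) (t : ι → ι → M) (h : ∀ i j, t i j = -t j i) :
    V [⋀^Fin 2]→ₗ[ℂ] M where
  toFun v := bilinOfTable b t (v 0) (v 1)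
  map_update_add' := by
    intro _ m i x y
    fin_cases i <;> simp [Function.update]
  map_update_smul' := by
    intro _ m i c x
    fin_cases i <;> simp [Function.update]
  map_eq_zero_of_eq' := by
    intro v i j hij hne
    have h01 : v 0 = v 1 := by
      fin_cases i <;> fin_cases j
      · exact absurd rfl hne
      · exact hij
      · exact hij.symm
      · exact absurd rfl hne
    change bilinOfTable b t (v 0) (v 1) = 0
    rw [h01]
    exact bilinOfTable_self b t h _

theorem altOfTable_apply (b : Module.Basis ι ℂ V) (t : ι → ι → M)
    (h : ∀ i j, t i j = -t j i) (v w : V) :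
    altOfTable b t h ![v, w] = bilinOfTable b t v w := rfl

theorem altOfTable_basis (b : Module.Basis ι ℂ V) (t : ι → ι → M)
    (h : ∀ i j, t i j = -t j i) (i j : ι) :
    altOfTable b t h ![b i, b j] = t i j := by
  rw [altOfTable_apply, bilinOfTable_basis]

end Table

/-! ## The doubled permutation representation of `S_n` -/

/-- The natural permutation representation of `S_n` on `W = ℂⁿ`, `(σ w)_i = w_{σ⁻¹ i}`. -/
def permRep (n : ℕ) : Representation ℂ (Equiv.Perm (Fin n)) (Fin n → ℂ) where
  toFun σ := LinearMap.funLeft ℂ ℂ (σ⁻¹ : Equiv.Perm (Fin n))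
  map_one' := by ext; simp [LinearMap.funLeft]
  map_mul' σ τ := by ext; simp [LinearMap.funLeft]

/-- The space `V = W* ⊕ W`. -/
abbrev DoubledSpace (n : ℕ) : Type := Module.Dual ℂ (Fin n → ℂ) × (Fin n → ℂ)

/-- The doubled permutation representation of `S_n` on `V = W* ⊕ W`. -/
def doubledPermRep (n : ℕ) : Representation ℂ (Equiv.Perm (Fin n)) (DoubledSpace n) :=
  (permRep n).dual.prod (permRep n)

/-- The basis `x_1, …, x_n, y_1, …, y_n` of `W* ⊕ W`: the `y_i` are the standard basis of `W`
and the `x_i` its dual basis. -/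
def xyBasis (n : ℕ) : Module.Basis (Fin n ⊕ Fin n) ℂ (DoubledSpace n) :=
  (Pi.basisFun ℂ (Fin n)).dualBasis.prod (Pi.basisFun ℂ (Fin n))

/-- The basis vector `x_i` of `W*`, as an element of `V`. -/
def xVec {n : ℕ} (i : Fin n) : DoubledSpace n := xyBasis n (Sum.inl i)

/-- The basis vector `y_i` of `W`, as an element of `V`. -/
def yVec {n : ℕ} (i : Fin n) : DoubledSpace n := xyBasis n (Sum.inr i)

/-- `x_{[n]} = x_1 + ⋯ + x_n`. -/
def xTot (n : ℕ) : DoubledSpace n := ∑ i, xVec i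

/-- `y_{[n]} = y_1 + ⋯ + y_n`. -/
def yTot (n : ℕ) : DoubledSpace n := ∑ i, yVec i

theorem doubledPermRep_xVec {n : ℕ} (σ : Equiv.Perm (Fin n)) (i : Fin n) :
    doubledPermRep n σ (xVec i) = xVec (σ i) := by
  refine Prod.ext ?_ ?_
  · refine (Pi.basisFun ℂ (Fin n)).ext fun j => ?_
    simp [doubledPermRep, xVec, xyBasis, permRep, LinearMap.funLeft, Module.Dual.transpose_apply]
    rfl
  · simp [doubledPermRep, xVec, xyBasis]

theorem doubledPermRep_yVec {n : ℕ} (σ : Equiv.Perm (Fin n)) (i : Fin n) :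
    doubledPermRep n σ (yVec i) = yVec (σ i) := by
  refine Prod.ext ?_ ?_
  · simp [doubledPermRep, yVec, xyBasis]
  · ext j
    simp [doubledPermRep, yVec, xyBasis, permRep, LinearMap.funLeft, Pi.single_apply,
      Equiv.symm_apply_eq]

/-! ## The maps `κ^L_1`, `κ^C_1` and `κ^C_ref` -/

/-- The seventeen complex parameters. -/
structure Params where
  (a₁ a₂ a₃ a₄ a₅ a₆ a₇ : ℂ)
  (b₁ b₂ b₃ b₄ b₅ b₆ b₇ : ℂ)
  (α β c : ℂ)

/-- The vector `κ^L_1(x_i, y_j)`, for `i = j` and for `i ≠ j`. -/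
def valXY {n : ℕ} (p : Params) (i j : Fin n) : DoubledSpace n :=
  if i = j then p.a₃ • xVec i + p.a₄ • xTot n + p.b₃ • yVec i + p.b₄ • yTot n
  else p.a₅ • xVec i + p.a₆ • xVec j + p.a₇ • xTot n
    + p.b₅ • yVec i + p.b₆ • yVec j + p.b₇ • yTot n

/-- Values of the identity component of `κ^L_1` on pairs of basis vectors
(`Sum.inl i` stands for `x_i`, `Sum.inr i` for `y_i`). -/
def tableL {n : ℕ} (p : Params) : Fin n ⊕ Fin n → Fin n ⊕ Fin n → DoubledSpace n
  | Sum.inl i, Sum.inl j => p.a₁ • (xVec i - xVec j) + p.b₁ • (yVec i - yVec j)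
  | Sum.inr i, Sum.inr j => p.a₂ • (xVec i - xVec j) + p.b₂ • (yVec i - yVec j)
  | Sum.inl i, Sum.inr j => valXY p i j
  | Sum.inr i, Sum.inl j => -valXY p j i

theorem tableL_swap {n : ℕ} (p : Params) (i j : Fin n ⊕ Fin n) :
    tableL p i j = -tableL p j i := by
  rcases i with i | i <;> rcases j with j | j <;> simp only [tableL, neg_neg] <;> module

/-- A table of scalars vanishing on pairs `x_i, x_j` and `y_i, y_j`, with value `t i j` on
`x_i, y_j`. -/
def tableC {n : ℕ} (t : Fin n → Fin n → ℂ) : Fin n ⊕ Fin n → Fin n ⊕ Fin n → ℂ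
  | Sum.inl _, Sum.inl _ => 0
  | Sum.inr _, Sum.inr _ => 0
  | Sum.inl i, Sum.inr j => t i j
  | Sum.inr i, Sum.inl j => -t j i

theorem tableC_swap {n : ℕ} (t : Fin n → Fin n → ℂ) (i j : Fin n ⊕ Fin n) :
    tableC t i j = -tableC t j i := by
  rcases i with i | i <;> rcases j with j | j <;> simp [tableC]

/-- The linear `2`-cochain `κ^L_1`, supported only on the identity. -/
def kappaLOne (n : ℕ) (p : Params) :
    TwoCochain (Equiv.Perm (Fin n)) (DoubledSpace n) (DoubledSpace n) :=
  fun g => if g = 1 then altOfTable (xyBasis n) (tableL p) (tableL_swap p) else 0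

/-- The constant `2`-cochain `κ^C_1`, supported only on the identity: `κ^C_1(x_i, y_i) = α` and
`κ^C_1(x_i, y_j) = β` for `i ≠ j`. -/
def kappaCOne (n : ℕ) (α β : ℂ) :
    TwoCochain (Equiv.Perm (Fin n)) (DoubledSpace n) ℂ :=
  fun g =>
    if g = 1 then
      altOfTable (xyBasis n) (tableC fun i j => if i = j then α else β)
        (tableC_swap _)
    else 0

open Classical in
/-- The constant `2`-cochain `κ^C_ref`, supported only on transpositions. For a transposition `g`
and an index `i` moved by `g`, `κ_g(x_i, y_i) = c = -κ_g(x_i, y_{g(i)})`; all the other values on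
pairs `x_i, y_j`, `x_i, x_j`, `y_i, y_j` vanish. -/
def kappaCRefl (n : ℕ) (c : ℂ) :
    TwoCochain (Equiv.Perm (Fin n)) (DoubledSpace n) ℂ :=
  fun g =>
    if g.IsSwap then
      altOfTable (xyBasis n)
        (tableC fun i j => if g i = i then 0 else if j = i then c else if j = g i then -c else 0)
        (tableC_swap _)
    else 0

/-! ## The parameter relations -/

/-- Conditions for the first obstruction. -/
def FirstObstructionConditions (n : ℕ) (p : Params) : Prop :=
  let ⟨a₁, a₂, a₃, a₄, a₅, a₆, a₇, b₁, b₂, b₃, b₄, b₅, b₆, b₇, _, _, _⟩ := p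
  a₁ * (a₅ + a₆ + n * a₇) - b₁ * a₂ - b₅ * a₆ + a₅ * (b₅ + b₆ + n * b₇)
      + b₇ * (a₃ - a₅ - a₆) = 0 ∧
  b₁ * (a₅ + a₆ + n * a₇) - b₁ * b₂ + b₁ * a₅ + b₅ * (b₅ - a₁ + n * b₇)
      + b₇ * (b₃ - b₅ - b₆) = 0 ∧
  -a₂ * (b₅ + b₆ + n * b₇) - a₂ * a₁ - a₂ * b₆ + a₆ * (a₆ + b₂ + n * a₇)
      + a₇ * (a₃ - a₅ - a₆) = 0 ∧
  -b₂ * (b₅ + b₆ + n * b₇) - a₂ * b₁ - a₆ * b₅ + b₆ * (a₅ + a₆ + n * a₇)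
      + a₇ * (b₃ - b₅ - b₆) = 0 ∧
  a₇ * (b₃ - b₅) - a₄ * b₆ + (b₄ - b₇) * (a₄ + (n - 1) * a₇ + a₆) = 0 ∧
  a₁ * (a₃ + n * a₄) + a₅ * (b₃ + n * b₄) + b₄ * (a₃ - a₅ - a₆) - a₂ * b₁ - b₅ * a₆ = 0 ∧
  -a₁ * (a₅ + a₆ + n * a₇) - a₅ * (b₅ + n * b₇) - b₇ * (a₃ - a₅ - a₆) + a₂ * b₁
      + b₃ * a₆ - a₃ * b₆ = 0 ∧
  b₇ * (b₃ - b₅) - b₄ * b₆ + (b₄ - b₇) * (a₁ + b₄ + (n - 1) * b₇ + b₆)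
      - b₁ * (a₄ - a₇) = 0 ∧
  b₁ * (a₅ - b₂ + a₃ + n * a₄) - b₅ * (a₁ + b₆ - b₃ - n * b₄) + b₄ * (b₃ - b₅ - b₆) = 0 ∧
  b₁ * (-b₂ + a₅ + a₃ + n * a₇) + b₅ * (b₅ + n * b₇) + b₇ * (b₃ - b₅ - b₆)
      - a₁ * (b₃ - b₆) = 0 ∧
  a₇ * (a₃ - a₆) - a₄ * a₅ + (a₄ - a₇) * (-b₂ + a₄ + (n - 1) * a₇ + a₅)
      + a₂ * (b₄ - b₇) = 0 ∧
  -a₂ * (a₁ + b₆ + b₃ + n * b₄) + a₆ * (b₂ - a₅ + a₃ + n * a₄) + a₄ * (a₃ - a₅ - a₆) = 0 ∧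
  a₂ * (a₁ + b₆ + b₃ + n * b₇) - a₆ * (a₆ + n * a₇) - a₇ * (a₃ - a₅ - a₆)
      - b₂ * (a₃ - a₅) = 0 ∧
  b₇ * (a₃ - a₆) - b₄ * a₅ + (a₄ - a₇) * (b₄ + (n - 1) * b₇ + b₅) = 0 ∧
  -b₂ * (b₃ + n * b₄) + b₆ * (a₃ + n * a₄) + a₄ * (b₃ - b₅ - b₆) - a₂ * b₁ - a₆ * b₅ = 0 ∧
  b₂ * (b₅ + b₆ + n * b₇) - b₆ * (a₆ + n * a₇) - a₇ * (b₃ - b₅ - b₆) + a₂ * b₁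
      + a₃ * b₅ - b₃ * a₅ = 0

/-- Conditions for `κ^C_1` to clear the second obstruction. -/
def SecondObstructionConditionsOne (n : ℕ) (p : Params) : Prop :=
  let ⟨a₁, _, a₃, a₄, a₅, a₆, a₇, _, b₂, b₃, b₄, b₅, b₆, b₇, α, β, _⟩ := p
  α * (a₁ - b₆ + b₄ - b₇) - β * (a₁ - b₃ + b₅ - (n - 1) * (b₄ - b₇)) = 0 ∧
  α * (-b₂ - a₅ + a₄ - a₇) + β * (b₂ + a₃ - a₆ + (n - 1) * (a₄ - a₇)) = 0

/-- Conditions for `κ^C_ref` to clear the second obstruction. -/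
def SecondObstructionConditionsRefl (p : Params) : Prop :=
  let ⟨a₁, _, a₃, _, a₅, a₆, _, _, b₂, b₃, _, b₅, b₆, _, _, _, c⟩ := p
  c * (a₁ - b₆) = 0 ∧ c * (2 * a₁ - b₃ + b₅ - b₆) = 0 ∧
  c * (a₅ + b₂) = 0 ∧ c * (2 * b₂ + a₃ + a₅ - a₆) = 0

/-- All the quadratic parameter relations of Lie orbifold algebra maps. -/
def LieOrbifoldConditions (n : ℕ) (p : Params) : Prop :=
  FirstObstructionConditions n p ∧ SecondObstructionConditionsOne n p ∧
    SecondObstructionConditionsRefl p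

/-- The simplified relations for the case `κ^C_ref ≠ 0`: first the four linear relations, then the
simplified conditions for the first obstruction, then those for `κ^C_1` to clear the second. -/
def SimplifiedConditions (n : ℕ) (p : Params) : Prop :=
  let ⟨a₁, a₂, a₃, a₄, a₅, a₆, a₇, b₁, b₂, b₃, b₄, b₅, b₆, b₇, α, β, _⟩ := p
  (a₁ = b₆ ∧ a₁ - b₃ + b₅ = 0 ∧ b₂ = -a₅ ∧ b₂ + a₃ - a₆ = 0) ∧
  (a₁ * (a₄ - a₇) - (b₄ - b₇) * (a₆ + a₄ + (n - 1) * a₇) = 0 ∧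
    b₁ * (a₄ - a₇) - (b₄ - b₇) * (b₆ + b₄ + (n - 1) * b₇) = 0 ∧
    (a₄ - a₇) * (a₅ + a₄ + (n - 1) * a₇) + a₂ * (b₄ - b₇) = 0 ∧
    (a₄ - a₇) * (b₅ + b₄ + (n - 1) * b₇) - a₅ * (b₄ - b₇) = 0 ∧
    a₁ * (a₃ + n * a₄) + a₅ * (b₃ + n * b₄) - b₁ * a₂ - b₅ * a₆ = 0 ∧
    a₁ * (a₃ + n * a₇) + a₅ * (b₃ + n * b₇) - b₁ * a₂ - b₅ * a₆ = 0 ∧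
    b₁ * (a₃ + n * a₄) + b₅ * (b₃ + n * b₄) - 2 * b₁ * b₂ - 2 * b₅ * b₆ = 0 ∧
    b₁ * (a₃ + n * a₇) + b₅ * (b₃ + n * b₇) - 2 * b₁ * b₂ - 2 * b₅ * b₆ = 0 ∧
    -a₂ * (b₃ + n * b₄) + a₆ * (a₃ + n * a₄) - 2 * a₁ * a₂ - 2 * a₅ * a₆ = 0 ∧
    -a₂ * (b₃ + n * b₇) + a₆ * (a₃ + n * a₇) - 2 * a₁ * a₂ - 2 * a₅ * a₆ = 0) ∧
  ((α + (n - 1) * β) * (b₄ - b₇) = 0 ∧ (α + (n - 1) * β) * (a₄ - a₇) = 0)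

end DrinfeldOrbifold

end

open scoped BigOperators

noncomputable section

namespace DrinfeldOrbifold

/-! A linear part supported on the identity decouples the defining equations. In `phi` only the
factorization `g = g * 1` survives, and there `v + ρ 1 v = 2v`, so `φ(α, κL)_g` is twice the cyclic
sum of `α_g` against the bracket `κL 1`. Since `ψ(κC)_1 = 0`, and `φ(κL, κL)_g = 0` for `g ≠ 1`, a
Lie orbifold algebra map amounts to invariance, the Jacobi identity for the bracket, `ψ(κC)_g = 0`
for `g ≠ 1`, and a vanishing cyclic sum of each `κC g` against the bracket
(`isLieOrbifoldAlgebraMap_iff`).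

The shape of the maps comes from two facts. First, coefficients of an equivariant bracket are
functions of three indices constant on `S_n`-orbits, and there are five orbits of triples; skewness
on pairs `x, x` and `y, y` leaves the fourteen parameters `a`, `b`, and the same reasoning leaves
`α`, `β` for the form at the identity. Second, `ψ(κC)_g = 0` with a nonzero form forces the vectors
`g x_a - x_a` to be proportional, so `g` is a transposition and the form is a multiple of the wedge
of two coordinate differences; conjugacy of transpositions leaves the single scalar `c`
(`exists_eq_kappaC`).

The relations come from evaluating the cyclic sums on basis triples. By alternation it suffices to
treat `xxx`, `yyy`, and the mixed types with indices distinct or with one `x` and one `y` index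
equal. The bracket gives (I) (`jacobi_iff`), the form at the identity gives (II)
(`cyclicSum_pairing_iff`), and the forms at transpositions give (III) (`cyclicSum_refl_iff`). When
`c ≠ 0`, (III) becomes four linear relations, and substituting them collapses (I) and (II) to (IV).
-/

theorem update_pair_one {V : Type*} (v w u : V) : Function.update ![v, w] 1 u = ![v, u] := by
  ext i; fin_cases i <;> rfl

/-! ### Cyclic sums, and the decoupled form of the defining equations -/

section Bilinear

variable {V M : Type*} [AddCommGroup V] [Module ℂ V] [AddCommGroup M] [Module ℂ M]

/-- The bilinear map underlying an alternating map in two variables. -/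
def toBilin (κ : V [⋀^Fin 2]→ₗ[ℂ] M) : V →ₗ[ℂ] V →ₗ[ℂ] M :=
  LinearMap.mk₂ ℂ (fun v w => κ ![v, w])
    (fun v v' w => by simpa using κ.map_vecCons_add ![w] v v')
    (fun c v w => by simpa using κ.map_vecCons_smul ![w] c v)
    (fun v w w' => by
      simpa only [update_pair_one] using κ.map_update_add ![v, w] 1 w w')
    (fun c v w => by
      simpa only [update_pair_one] using κ.map_update_smul ![v, w] 1 c w)

theorem toBilin_apply (κ : V [⋀^Fin 2]→ₗ[ℂ] M) (v w : V) : toBilin κ v w = κ ![v, w] := rfl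

theorem toBilin_self (κ : V [⋀^Fin 2]→ₗ[ℂ] M) (v : V) : toBilin κ v v = 0 :=
  κ.map_eq_zero_of_eq _ (i := 0) (j := 1) rfl (by simp)

theorem toBilin_swap (κ : V [⋀^Fin 2]→ₗ[ℂ] M) (v w : V) : toBilin κ v w = -toBilin κ w v := by
  have h := toBilin_self κ (v + w)
  simp only [map_add, LinearMap.add_apply, toBilin_self, zero_add, add_zero] at h
  exact eq_neg_of_add_eq_zero_right h

theorem toBilin_injective : Function.Injective (toBilin (V := V) (M := M)) := by
  intro κ κ' h
  ext v
  have hv : v = ![v 0, v 1] := by ext i; fin_cases i <;> rfl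
  rw [hv]
  exact LinearMap.congr_fun₂ h (v 0) (v 1)

@[simp] theorem toBilin_zero : toBilin (0 : V [⋀^Fin 2]→ₗ[ℂ] M) = 0 := rfl

theorem toBilin_altOfTable {ι : Type*} (b : Module.Basis ι ℂ V) (t : ι → ι → M)
    (h : ∀ i j, t i j = -t j i) : toBilin (altOfTable b t h) = bilinOfTable b t := rfl

/-- The cyclic sum `A(v₁, B(v₂, v₃)) + A(v₂, B(v₃, v₁)) + A(v₃, B(v₁, v₂))`. -/
def cyclicSum (A : V →ₗ[ℂ] V →ₗ[ℂ] M) (B : V →ₗ[ℂ] V →ₗ[ℂ] V) (v₁ v₂ v₃ : V) : M :=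
  A v₁ (B v₂ v₃) + A v₂ (B v₃ v₁) + A v₃ (B v₁ v₂)

theorem cyclicSum_rotate (A : V →ₗ[ℂ] V →ₗ[ℂ] M) (B : V →ₗ[ℂ] V →ₗ[ℂ] V) (v₁ v₂ v₃ : V) :
    cyclicSum A B v₁ v₂ v₃ = cyclicSum A B v₂ v₃ v₁ := by
  unfold cyclicSum; abel

theorem cyclicSum_self_left (A : V →ₗ[ℂ] V →ₗ[ℂ] M) {B : V →ₗ[ℂ] V →ₗ[ℂ] V}
    (hB : ∀ v w, B v w = -B w v) (v w : V) : cyclicSum A B v v w = 0 := by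
  have h0 : B v v = 0 := by
    have h : (2 : ℂ) • B v v = 0 := by
      rw [two_smul]; nth_rewrite 1 [hB v v]; exact neg_add_cancel _
    exact (smul_eq_zero_iff_right two_ne_zero).mp h
  unfold cyclicSum
  rw [h0, hB w v]
  simp

/-- Skewness of the inner map `B` alone, combined with `cyclicSum_rotate`, makes the cyclic sum
alternating in its three arguments. This is what permits checking only representatives of basis
triples. -/
theorem cyclicSum_swap (A : V →ₗ[ℂ] V →ₗ[ℂ] M) {B : V →ₗ[ℂ] V →ₗ[ℂ] V}
    (hB : ∀ v w, B v w = -B w v) (u v w : V) : cyclicSum A B u v w = -cyclicSum A B v u w := by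
  unfold cyclicSum
  rw [hB v w, hB w u, hB u v]
  simp only [map_neg]
  abel

theorem cyclicSum_eq_zero_of_basis {ι : Type*} (b : Module.Basis ι ℂ V)
    {A : V →ₗ[ℂ] V →ₗ[ℂ] M} {B : V →ₗ[ℂ] V →ₗ[ℂ] V}
    (h : ∀ i j k, cyclicSum A B (b i) (b j) (b k) = 0) (u v w : V) : cyclicSum A B u v w = 0 := by
  -- Linear extension in the first slot only; the other two slots are brought there by rotation.
  have step : ∀ v w : V, (∀ i, cyclicSum A B (b i) v w = 0) → ∀ u, cyclicSum A B u v w = 0 := by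
    intro v w hi u
    have hu : u ∈ Submodule.span ℂ (Set.range b) := by rw [b.span_eq]; trivial
    induction hu using Submodule.span_induction with
    | mem x hx => obtain ⟨i, rfl⟩ := hx; exact hi i
    | zero => simp [cyclicSum]
    | add x y _ _ hx hy =>
      have : cyclicSum A B (x + y) v w = cyclicSum A B x v w + cyclicSum A B y v w := by
        simp only [cyclicSum, map_add, LinearMap.add_apply]; abel
      rw [this, hx, hy, add_zero]
    | smul c x _ hx =>
      have : cyclicSum A B (c • x) v w = c • cyclicSum A B x v w := by
        simp only [cyclicSum, map_smul, LinearMap.smul_apply, smul_add]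
      rw [this, hx, smul_zero]
  refine step v w (fun i => ?_) u
  rw [cyclicSum_rotate]
  refine step w (b i) (fun j => ?_) v
  rw [cyclicSum_rotate]
  refine step (b i) (b j) (fun k => ?_) w
  exact h k i j

variable {G : Type*} [Group G] [Fintype G] [DecidableEq G]

theorem phi_eq_of_support (ρ : Representation ℂ G V) (α : TwoCochain G V M)
    {β : TwoCochain G V V} (hβ : ∀ g, g ≠ 1 → β g = 0) (g : G) (v₁ v₂ v₃ : V) :
    phi ρ α β g v₁ v₂ v₃ = (2 : ℂ) • cyclicSum (toBilin (α g)) (toBilin (β 1)) v₁ v₂ v₃ := by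
  unfold phi
  -- The inner cochain `β` vanishes off the identity, so `y = 1` and hence `x = g`.
  rw [Finset.sum_eq_single (g, 1)]
  · simp only [phiPair, ← toBilin_apply, map_one, Module.End.one_apply, cyclicSum, map_add,
      LinearMap.add_apply, two_smul]
    abel
  · rintro ⟨x, y⟩ hxy hne
    have hx : x * y = g := by simpa using hxy
    have hy : y ≠ 1 := by
      rintro rfl
      exact hne (by rw [← hx, mul_one])
    simp [phiPair, ← toBilin_apply, hβ y hy]
  · intro h
    exact absurd (by simp) h

/-- The conditions on the image and on `ψ(κL)` are automatic: `ρ 1` is the identity, and `κL g = 0`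
for `g ≠ 1`. The first obstruction splits into the Jacobi identity at `g = 1`, where `ψ(κC)`
vanishes, and `ψ(κC)_g = 0` at `g ≠ 1`, where the left side vanishes. -/
theorem isLieOrbifoldAlgebraMap_iff (ρ : Representation ℂ G V) (κL : TwoCochain G V V)
    (κC : TwoCochain G V ℂ) :
    IsLieOrbifoldAlgebraMap ρ κL κC ↔
      (∀ g, g ≠ 1 → κL g = 0) ∧ IsInvariantLinear ρ κL ∧ IsInvariantConst ρ κC ∧
      (∀ g, g ≠ 1 → ∀ v₁ v₂ v₃, psiConst ρ κC g v₁ v₂ v₃ = 0) ∧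
      (∀ v₁ v₂ v₃, cyclicSum (toBilin (κL 1)) (toBilin (κL 1)) v₁ v₂ v₃ = 0) ∧
      ∀ g v₁ v₂ v₃, cyclicSum (toBilin (κC g)) (toBilin (κL 1)) v₁ v₂ v₃ = 0 := by
  have h2 : (2 : ℂ) ≠ 0 := two_ne_zero
  have hψ : ∀ v₁ v₂ v₃, psiConst ρ κC 1 v₁ v₂ v₃ = 0 := by simp [psiConst]
  constructor
  · rintro ⟨h, hs⟩
    have h1 := h.first_obstruction
    have h3 := h.second_obstruction
    simp only [phi_eq_of_support ρ _ hs] at h1 h3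
    refine ⟨hs, h.invariant_linear, h.invariant_const, fun g hg v₁ v₂ v₃ => ?_,
      fun v₁ v₂ v₃ => ?_, fun g v₁ v₂ v₃ => (smul_eq_zero_iff_right h2).mp (h3 g v₁ v₂ v₃)⟩
    · have := h1 g v₁ v₂ v₃
      rw [hs g hg] at this
      simpa [cyclicSum] using this.symm
    · have := h1 1 v₁ v₂ v₃
      rw [hψ, smul_zero] at this
      exact (smul_eq_zero_iff_right h2).mp this
  · rintro ⟨hs, hL, hC, hpsi, hJ, hK⟩
    refine ⟨⟨fun g v w => ?_, hL, hC, fun g v₁ v₂ v₃ => ?_, fun g v₁ v₂ v₃ => ?_,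
      fun g v₁ v₂ v₃ => ?_⟩, hs⟩
    · by_cases hg : g = 1
      · subst hg; simp
      · simp [hs g hg]
    · by_cases hg : g = 1
      · subst hg; simp [psiLinear]
      · simp [psiLinear, hs g hg]
    · rw [phi_eq_of_support ρ _ hs]
      by_cases hg : g = 1
      · subst hg; rw [hJ, hψ]
      · rw [hpsi g hg, hs g hg]; simp [cyclicSum]
    · rw [phi_eq_of_support ρ _ hs, hK, smul_zero]

end Bilinear

/-! ### Coordinates on `W* ⊕ W` and reduction to basis triples -/

section Coordinates

variable {n : ℕ}

/-- The coefficient of `x_m`. -/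
def xCoord (m : Fin n) : DoubledSpace n →ₗ[ℂ] ℂ := (xyBasis n).coord (Sum.inl m)

/-- The coefficient of `y_m`. -/
def yCoord (m : Fin n) : DoubledSpace n →ₗ[ℂ] ℂ := (xyBasis n).coord (Sum.inr m)

@[simp] theorem xCoord_xVec (m i : Fin n) : xCoord m (xVec i) = if i = m then 1 else 0 := by
  simp [xCoord, xVec, Module.Basis.repr_self, Finsupp.single_apply]

@[simp] theorem xCoord_yVec (m i : Fin n) : xCoord m (yVec i) = 0 := by
  simp [xCoord, yVec, Module.Basis.repr_self]

@[simp] theorem yCoord_xVec (m i : Fin n) : yCoord m (xVec i) = 0 := by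
  simp [yCoord, xVec, Module.Basis.repr_self]

@[simp] theorem yCoord_yVec (m i : Fin n) : yCoord m (yVec i) = if i = m then 1 else 0 := by
  simp [yCoord, yVec, Module.Basis.repr_self, Finsupp.single_apply]

@[simp] theorem xCoord_xTot (m : Fin n) : xCoord m (xTot n) = 1 := by simp [xTot]
@[simp] theorem xCoord_yTot (m : Fin n) : xCoord m (yTot n) = 0 := by simp [yTot]
@[simp] theorem yCoord_xTot (m : Fin n) : yCoord m (xTot n) = 0 := by simp [xTot]
@[simp] theorem yCoord_yTot (m : Fin n) : yCoord m (yTot n) = 1 := by simp [yTot]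

theorem sum_xVec : ∑ i, xVec i = xTot n := rfl

theorem sum_yVec : ∑ i, yVec i = yTot n := rfl

theorem ext_coord {v w : DoubledSpace n} (hx : ∀ m, xCoord m v = xCoord m w)
    (hy : ∀ m, yCoord m v = yCoord m w) : v = w :=
  (xyBasis n).ext_elem fun i => by rcases i with m | m; exacts [hx m, hy m]

theorem linearMap_ext_xy {M : Type*} [AddCommGroup M] [Module ℂ M] {f g : DoubledSpace n →ₗ[ℂ] M}
    (hx : ∀ i, f (xVec i) = g (xVec i)) (hy : ∀ i, f (yVec i) = g (yVec i)) : f = g :=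
  (xyBasis n).ext fun i => by rcases i with m | m; exacts [hx m, hy m]

theorem bilin_ext_xy {M : Type*} [AddCommGroup M] [Module ℂ M]
    {A B : DoubledSpace n →ₗ[ℂ] DoubledSpace n →ₗ[ℂ] M}
    (hxx : ∀ i j, A (xVec i) (xVec j) = B (xVec i) (xVec j))
    (hxy : ∀ i j, A (xVec i) (yVec j) = B (xVec i) (yVec j))
    (hyx : ∀ i j, A (yVec i) (xVec j) = B (yVec i) (xVec j))
    (hyy : ∀ i j, A (yVec i) (yVec j) = B (yVec i) (yVec j)) : A = B :=
  linearMap_ext_xy (fun i => linearMap_ext_xy (hxx i) (hxy i))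
    (fun i => linearMap_ext_xy (hyx i) (hyy i))

theorem xCoord_doubledPermRep (σ : Equiv.Perm (Fin n)) (m : Fin n) (v : DoubledSpace n) :
    xCoord (σ m) (doubledPermRep n σ v) = xCoord m v := by
  have : (xCoord (σ m)).comp (doubledPermRep n σ) = xCoord m :=
    linearMap_ext_xy (fun i => by simp [doubledPermRep_xVec])
      (fun i => by simp [doubledPermRep_yVec])
  exact LinearMap.congr_fun this v

theorem yCoord_doubledPermRep (σ : Equiv.Perm (Fin n)) (m : Fin n) (v : DoubledSpace n) :
    yCoord (σ m) (doubledPermRep n σ v) = yCoord m v := by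
  have : (yCoord (σ m)).comp (doubledPermRep n σ) = yCoord m :=
    linearMap_ext_xy (fun i => by simp [doubledPermRep_xVec])
      (fun i => by simp [doubledPermRep_yVec])
  exact LinearMap.congr_fun this v

theorem doubledPermRep_xTot (σ : Equiv.Perm (Fin n)) :
    doubledPermRep n σ (xTot n) = xTot n := by
  simp only [xTot, map_sum, doubledPermRep_xVec]
  exact Equiv.sum_comp σ xVec

theorem doubledPermRep_yTot (σ : Equiv.Perm (Fin n)) :
    doubledPermRep n σ (yTot n) = yTot n := by
  simp only [yTot, map_sum, doubledPermRep_yVec]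
  exact Equiv.sum_comp σ yVec

/-- A cyclic sum of skew-symmetric maps on `V` vanishes as soon as it vanishes on the
representatives of the triples of basis vectors. -/
theorem cyclicSum_eq_zero_of_xy {M : Type*} [AddCommGroup M] [Module ℂ M]
    {A : DoubledSpace n →ₗ[ℂ] DoubledSpace n →ₗ[ℂ] M}
    {B : DoubledSpace n →ₗ[ℂ] DoubledSpace n →ₗ[ℂ] DoubledSpace n}
    (hB : ∀ v w, B v w = -B w v)
    (hxxx : ∀ i j k, cyclicSum A B (xVec i) (xVec j) (xVec k) = 0)
    (hyyy : ∀ i j k, cyclicSum A B (yVec i) (yVec j) (yVec k) = 0)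
    (hxxy : ∀ i j k, i ≠ j → i ≠ k → j ≠ k → cyclicSum A B (xVec i) (xVec j) (yVec k) = 0)
    (hxxy' : ∀ i j, i ≠ j → cyclicSum A B (xVec i) (xVec j) (yVec i) = 0)
    (hxyy : ∀ i j k, i ≠ j → i ≠ k → j ≠ k → cyclicSum A B (xVec k) (yVec i) (yVec j) = 0)
    (hxyy' : ∀ i j, i ≠ j → cyclicSum A B (xVec i) (yVec i) (yVec j) = 0)
    (u v w : DoubledSpace n) : cyclicSum A B u v w = 0 := by
  have h1 : ∀ i j k, cyclicSum A B (xVec i) (xVec j) (yVec k) = 0 := by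
    intro i j k
    by_cases hij : i = j
    · subst hij; exact cyclicSum_self_left A hB _ _
    by_cases hik : i = k
    · subst hik; exact hxxy' i j hij
    by_cases hjk : j = k
    · subst hjk; rw [cyclicSum_swap A hB, hxxy' j i (Ne.symm hij), neg_zero]
    exact hxxy i j k hij hik hjk
  have h2 : ∀ i j k, cyclicSum A B (xVec k) (yVec i) (yVec j) = 0 := by
    intro i j k
    by_cases hij : i = j
    · subst hij
      rw [cyclicSum_rotate]; exact cyclicSum_self_left A hB _ _
    by_cases hik : i = k
    · subst hik; exact hxyy' i j hij
    by_cases hjk : j = k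
    · subst hjk
      rw [cyclicSum_rotate, cyclicSum_swap A hB, ← cyclicSum_rotate, hxyy' j i (Ne.symm hij),
        neg_zero]
    exact hxyy i j k hij hik hjk
  refine cyclicSum_eq_zero_of_basis (xyBasis n) ?_ u v w
  rintro (i | i) (j | j) (k | k)
  · exact hxxx i j k
  · exact h1 i j k
  · rw [cyclicSum_rotate, cyclicSum_rotate]; exact h1 k i j
  · exact h2 j k i
  · rw [cyclicSum_rotate]; exact h1 j k i
  · rw [cyclicSum_rotate]; exact h2 k i j
  · rw [cyclicSum_rotate, cyclicSum_rotate]; exact h2 i j k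
  · exact hyyy i j k

end Coordinates

/-! ### The bracket of `κ^L_1`: values, sums and equivariance -/

section Bracket

variable {n : ℕ} (p : Params)

/-- The bilinear form of `κ^L_1`. -/
def bracket (n : ℕ) (p : Params) :
    DoubledSpace n →ₗ[ℂ] DoubledSpace n →ₗ[ℂ] DoubledSpace n :=
  bilinOfTable (xyBasis n) (tableL p)

theorem toBilin_kappaLOne : toBilin (kappaLOne n p 1) = bracket n p := by
  simp [kappaLOne, toBilin_altOfTable, bracket]

theorem bracket_swap (v w : DoubledSpace n) : bracket n p v w = -bracket n p w v := by
  rw [← toBilin_kappaLOne]; exact toBilin_swap _ v w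

theorem bracket_xx (i j : Fin n) : bracket n p (xVec i) (xVec j)
    = p.a₁ • (xVec i - xVec j) + p.b₁ • (yVec i - yVec j) :=
  bilinOfTable_basis (xyBasis n) (tableL p) (Sum.inl i) (Sum.inl j)

theorem bracket_yy (i j : Fin n) : bracket n p (yVec i) (yVec j)
    = p.a₂ • (xVec i - xVec j) + p.b₂ • (yVec i - yVec j) :=
  bilinOfTable_basis (xyBasis n) (tableL p) (Sum.inr i) (Sum.inr j)

theorem bracket_xy (i j : Fin n) : bracket n p (xVec i) (yVec j) = valXY p i j :=
  bilinOfTable_basis (xyBasis n) (tableL p) (Sum.inl i) (Sum.inr j)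

theorem bracket_yx (i j : Fin n) : bracket n p (yVec i) (xVec j) = -valXY p j i :=
  bilinOfTable_basis (xyBasis n) (tableL p) (Sum.inr i) (Sum.inl j)

theorem valXY_self (i : Fin n) : valXY p i i
    = p.a₃ • xVec i + p.a₄ • xTot n + p.b₃ • yVec i + p.b₄ • yTot n := by
  simp [valXY]

theorem valXY_of_ne {i j : Fin n} (h : i ≠ j) : valXY p i j
    = p.a₅ • xVec i + p.a₆ • xVec j + p.a₇ • xTot n
      + p.b₅ • yVec i + p.b₆ • yVec j + p.b₇ • yTot n := by
  simp [valXY, h]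

/-- Writing the value as the off-diagonal formula plus a correction on the diagonal lets sums over
one index be evaluated by `Finset.sum_ite_eq`. -/
theorem valXY_eq (i j : Fin n) : valXY p i j
    = p.a₅ • xVec i + p.a₆ • xVec j + p.a₇ • xTot n
      + p.b₅ • yVec i + p.b₆ • yVec j + p.b₇ • yTot n
      + if i = j then (p.a₃ - p.a₅ - p.a₆) • xVec i + (p.a₄ - p.a₇) • xTot n
          + (p.b₃ - p.b₅ - p.b₆) • yVec i + (p.b₄ - p.b₇) • yTot n else 0 := by
  by_cases h : i = j
  · subst h; rw [valXY_self, if_pos rfl]; module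
  · rw [valXY_of_ne p h, if_neg h, add_zero]

/-- Iterated brackets produce `xTot` and `yTot`, so brackets against these totals are needed; they
are the source of every `n` in (I). -/
theorem bracket_x_xTot (i : Fin n) : bracket n p (xVec i) (xTot n)
    = (n * p.a₁) • xVec i - p.a₁ • xTot n + (n * p.b₁) • yVec i - p.b₁ • yTot n := by
  have : bracket n p (xVec i) (xTot n)
      = ∑ j, (p.a₁ • (xVec i - xVec j) + p.b₁ • (yVec i - yVec j)) := by
    rw [xTot, map_sum]; simp only [bracket_xx]
  rw [this]
  simp only [Finset.sum_add_distrib, ← Finset.smul_sum, Finset.sum_sub_distrib, sum_xVec, sum_yVec,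
    Finset.sum_const, Finset.card_univ, Fintype.card_fin, ← Nat.cast_smul_eq_nsmul ℂ]
  module

theorem bracket_y_yTot (i : Fin n) : bracket n p (yVec i) (yTot n)
    = (n * p.a₂) • xVec i - p.a₂ • xTot n + (n * p.b₂) • yVec i - p.b₂ • yTot n := by
  have : bracket n p (yVec i) (yTot n)
      = ∑ j, (p.a₂ • (xVec i - xVec j) + p.b₂ • (yVec i - yVec j)) := by
    rw [yTot, map_sum]; simp only [bracket_yy]
  rw [this]
  simp only [Finset.sum_add_distrib, ← Finset.smul_sum, Finset.sum_sub_distrib, sum_xVec, sum_yVec,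
    Finset.sum_const, Finset.card_univ, Fintype.card_fin, ← Nat.cast_smul_eq_nsmul ℂ]
  module

theorem bracket_x_yTot (i : Fin n) : bracket n p (xVec i) (yTot n)
    = (p.a₃ + (n - 1) * p.a₅ - p.a₆) • xVec i + (p.a₄ + (n - 1) * p.a₇ + p.a₆) • xTot n
      + (p.b₃ + (n - 1) * p.b₅ - p.b₆) • yVec i + (p.b₄ + (n - 1) * p.b₇ + p.b₆) • yTot n := by
  have : bracket n p (xVec i) (yTot n) = ∑ j, valXY p i j := by
    rw [yTot, map_sum]; simp only [bracket_xy]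
  rw [this]
  simp only [valXY_eq, Finset.sum_add_distrib, ← Finset.smul_sum, sum_xVec, sum_yVec,
    Finset.sum_const, Finset.card_univ, Fintype.card_fin, ← Nat.cast_smul_eq_nsmul ℂ,
    Finset.sum_ite_eq, Finset.mem_univ, if_true]
  module

theorem bracket_y_xTot (i : Fin n) : bracket n p (yVec i) (xTot n)
    = -((p.a₃ + (n - 1) * p.a₆ - p.a₅) • xVec i + (p.a₄ + (n - 1) * p.a₇ + p.a₅) • xTot n
      + (p.b₃ + (n - 1) * p.b₆ - p.b₅) • yVec i + (p.b₄ + (n - 1) * p.b₇ + p.b₅) • yTot n) := by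
  have : bracket n p (yVec i) (xTot n) = -∑ j, valXY p j i := by
    rw [xTot, map_sum, ← Finset.sum_neg_distrib]; simp only [bracket_yx]
  rw [this, neg_inj]
  simp only [valXY_eq, Finset.sum_add_distrib, ← Finset.smul_sum, sum_xVec, sum_yVec,
    Finset.sum_const, Finset.card_univ, Fintype.card_fin, ← Nat.cast_smul_eq_nsmul ℂ,
    Finset.sum_ite_eq', Finset.mem_univ, if_true]
  module

theorem bracket_equivariant (σ : Equiv.Perm (Fin n)) (v w : DoubledSpace n) :
    doubledPermRep n σ (bracket n p v w)
      = bracket n p (doubledPermRep n σ v) (doubledPermRep n σ w) := by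
  have hxy : ∀ i j, doubledPermRep n σ (valXY p i j) = valXY p (σ i) (σ j) := by
    intro i j
    by_cases h : i = j
    · subst h
      simp only [valXY_self, map_add, map_smul, doubledPermRep_xVec, doubledPermRep_yVec,
        doubledPermRep_xTot, doubledPermRep_yTot]
    · simp only [valXY_of_ne p h, valXY_of_ne p (σ.injective.ne h), map_add, map_smul,
        doubledPermRep_xVec, doubledPermRep_yVec, doubledPermRep_xTot, doubledPermRep_yTot]
  have : (bracket n p).compr₂ (doubledPermRep n σ)
      = (bracket n p).compl₁₂ (doubledPermRep n σ) (doubledPermRep n σ) := by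
    apply bilin_ext_xy <;> intro i j <;>
    simp only [LinearMap.compr₂_apply, LinearMap.compl₁₂_apply, doubledPermRep_xVec,
      doubledPermRep_yVec, bracket_xx, bracket_yy, bracket_xy, bracket_yx, map_neg, hxy, map_add,
      map_smul, map_sub]
  exact LinearMap.congr_fun₂ this v w

theorem kappaLOne_invariant : IsInvariantLinear (doubledPermRep n) (kappaLOne n p) := by
  intro g h v w
  by_cases hg : g = 1
  · subst hg
    simp only [mul_one, mul_inv_cancel, ← toBilin_apply, toBilin_kappaLOne]
    exact bracket_equivariant p h v w
  · have : h * g * h⁻¹ ≠ 1 := by simpa using hg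
    simp [kappaLOne, hg]

end Bracket

/-! ### The Jacobi identity and conditions (I) -/

section Jacobi

variable {n : ℕ} (p : Params)

/-- The diagonal values and the totals are symmetric in `i, j` and cancel. What remains is a
difference of a vector at `i` and one at `j`, so it telescopes around a cycle `i, j, k`; this kills
the Jacobi sums of type `xxx` and `yyy`. -/
theorem valXY_sub_swap (i j : Fin n) : valXY p i j - valXY p j i
    = (p.a₅ - p.a₆) • (xVec i - xVec j) + (p.b₅ - p.b₆) • (yVec i - yVec j) := by
  by_cases h : i = j
  · subst h; simp
  · rw [valXY_of_ne p h, valXY_of_ne p (Ne.symm h)]; module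

theorem jacobi_xxx (i j k : Fin n) :
    cyclicSum (bracket n p) (bracket n p) (xVec i) (xVec j) (xVec k) = 0 := by
  simp only [cyclicSum, bracket_xx, bracket_xy, map_add, map_sub, map_smul]
  linear_combination (norm := module) p.b₁ • (valXY_sub_swap p i j + valXY_sub_swap p j k
    + valXY_sub_swap p k i)

theorem jacobi_yyy (i j k : Fin n) :
    cyclicSum (bracket n p) (bracket n p) (yVec i) (yVec j) (yVec k) = 0 := by
  simp only [cyclicSum, bracket_yy, bracket_yx, map_add, map_sub, map_smul]
  linear_combination (norm := module) p.a₂ • (valXY_sub_swap p i j + valXY_sub_swap p j k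
    + valXY_sub_swap p k i)

/-- By equivariance the result involves only vectors at `i, j, k` and totals; it is skew in `i, j`,
which rules out the vectors at `k` and the totals. Two scalar conditions remain. -/
theorem jacobi_xxy {i j k : Fin n} (hij : i ≠ j) (hik : i ≠ k) (hjk : j ≠ k) :
    cyclicSum (bracket n p) (bracket n p) (xVec i) (xVec j) (yVec k)
      = (p.a₁ * (p.a₅ + p.a₆ + n * p.a₇) - p.b₁ * p.a₂ - p.b₅ * p.a₆ + p.a₅ * (p.b₅ + p.b₆ +
        n * p.b₇) + p.b₇ * (p.a₃ - p.a₅ - p.a₆)) • (xVec i - xVec j)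
      + (p.b₁ * (p.a₅ + p.a₆ + n * p.a₇) - p.b₁ * p.b₂ + p.b₁ * p.a₅ + p.b₅ * (p.b₅ - p.a₁ +
        n * p.b₇) + p.b₇ * (p.b₃ - p.b₅ - p.b₆)) • (yVec i - yVec j) := by
  simp only [cyclicSum, bracket_xx, bracket_yy, bracket_xy, bracket_yx, valXY_of_ne p hik, valXY_of_ne p hjk,
    valXY_of_ne p hij, valXY_of_ne p hij.symm,
    map_add, map_sub, map_neg, map_smul, bracket_x_xTot, bracket_x_yTot]
  module

theorem jacobi_xyy {i j k : Fin n} (hij : i ≠ j) (hik : i ≠ k) (hjk : j ≠ k) :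
    cyclicSum (bracket n p) (bracket n p) (xVec k) (yVec i) (yVec j)
      = (-p.a₂ * (p.b₅ + p.b₆ + n * p.b₇) - p.a₂ * p.a₁ - p.a₂ * p.b₆ + p.a₆ * (p.a₆ + p.b₂
        + n * p.a₇) + p.a₇ * (p.a₃ - p.a₅ - p.a₆)) • (xVec i - xVec j)
      + (-p.b₂ * (p.b₅ + p.b₆ + n * p.b₇) - p.a₂ * p.b₁ - p.a₆ * p.b₅ + p.b₆ * (p.a₅ + p.a₆
        + n * p.a₇) + p.a₇ * (p.b₃ - p.b₅ - p.b₆)) • (yVec i - yVec j) := by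
  simp only [cyclicSum, bracket_xx, bracket_yy, bracket_xy, bracket_yx, valXY_of_ne p hik.symm, valXY_of_ne p hjk.symm,
    valXY_of_ne p hij, valXY_of_ne p hij.symm,
    map_add, map_sub, map_neg, map_smul, bracket_y_xTot,
    bracket_y_yTot]
  module

theorem jacobi_xxy_eq {i j : Fin n} (hij : i ≠ j) :
    cyclicSum (bracket n p) (bracket n p) (xVec i) (xVec j) (yVec i)
      = -(-p.a₁ * (p.a₅ + p.a₆ + n * p.a₇) - p.a₅ * (p.b₅ + n * p.b₇) - p.b₇ * (p.a₃ - p.a₅ -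
        p.a₆) + p.a₂ * p.b₁ + p.b₃ * p.a₆ - p.a₃ * p.b₆) • xVec i
      + -(p.a₁ * (p.a₃ + n * p.a₄) + p.a₅ * (p.b₃ + n * p.b₄) + p.b₄ * (p.a₃ - p.a₅ - p.a₆) -
        p.a₂ * p.b₁ - p.b₅ * p.a₆) • xVec j
      + -(p.a₇ * (p.b₃ - p.b₅) - p.a₄ * p.b₆ + (p.b₄ - p.b₇) * (p.a₄ + (n - 1) * p.a₇ +
        p.a₆)) • xTot n
      + (p.b₁ * (-p.b₂ + p.a₅ + p.a₃ + n * p.a₇) + p.b₅ * (p.b₅ + n * p.b₇) + p.b₇ * (p.b₃ -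
        p.b₅ - p.b₆) - p.a₁ * (p.b₃ - p.b₆)) • yVec i
      + -(p.b₁ * (p.a₅ - p.b₂ + p.a₃ + n * p.a₄) - p.b₅ * (p.a₁ + p.b₆ - p.b₃ - n * p.b₄) +
        p.b₄ * (p.b₃ - p.b₅ - p.b₆)) • yVec j
      + -(p.b₇ * (p.b₃ - p.b₅) - p.b₄ * p.b₆ + (p.b₄ - p.b₇) * (p.a₁ + p.b₄ + (n - 1) * p.b₇
        + p.b₆) - p.b₁ * (p.a₄ - p.a₇)) • yTot n := by
  simp only [cyclicSum, bracket_xx, bracket_yy, bracket_xy, bracket_yx, valXY_of_ne p hij,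
    valXY_of_ne p hij.symm, valXY_self,
    map_add, map_sub, map_neg, map_smul, bracket_x_xTot, bracket_x_yTot]
  module

theorem jacobi_xyy_eq {i j : Fin n} (hij : i ≠ j) :
    cyclicSum (bracket n p) (bracket n p) (xVec i) (yVec i) (yVec j)
      = -(p.a₂ * (p.a₁ + p.b₆ + p.b₃ + n * p.b₇) - p.a₆ * (p.a₆ + n * p.a₇) - p.a₇ * (p.a₃ -
        p.a₅ - p.a₆) - p.b₂ * (p.a₃ - p.a₅)) • xVec i
      + -(-p.a₂ * (p.a₁ + p.b₆ + p.b₃ + n * p.b₄) + p.a₆ * (p.b₂ - p.a₅ + p.a₃ + n * p.a₄) +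
        p.a₄ * (p.a₃ - p.a₅ - p.a₆)) • xVec j
      + -(p.a₇ * (p.a₃ - p.a₆) - p.a₄ * p.a₅ + (p.a₄ - p.a₇) * (-p.b₂ + p.a₄ + (n - 1) * p.a₇
        + p.a₅) + p.a₂ * (p.b₄ - p.b₇)) • xTot n
      + -(p.b₂ * (p.b₅ + p.b₆ + n * p.b₇) - p.b₆ * (p.a₆ + n * p.a₇) - p.a₇ * (p.b₃ - p.b₅ -
        p.b₆) + p.a₂ * p.b₁ + p.a₃ * p.b₅ - p.b₃ * p.a₅) • yVec i
      + -(-p.b₂ * (p.b₃ + n * p.b₄) + p.b₆ * (p.a₃ + n * p.a₄) + p.a₄ * (p.b₃ - p.b₅ - p.b₆)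
        - p.a₂ * p.b₁ - p.a₆ * p.b₅) • yVec j
      + -(p.b₇ * (p.a₃ - p.a₆) - p.b₄ * p.a₅ + (p.a₄ - p.a₇) * (p.b₄ + (n - 1) * p.b₇ +
        p.b₅)) • yTot n := by
  simp only [cyclicSum, bracket_xx, bracket_yy, bracket_xy, bracket_yx, valXY_of_ne p hij,
    valXY_of_ne p hij.symm, valXY_self,
    map_add, map_sub, map_neg, map_smul, bracket_y_xTot,
    bracket_y_yTot]
  module

theorem coeff_eq_zero_of_pair {i j : Fin n} (hij : i ≠ j) {c d : ℂ}
    (h : c • (xVec i - xVec j) + d • (yVec i - yVec j) = (0 : DoubledSpace n)) :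
    c = 0 ∧ d = 0 := by
  have h1 := congrArg (xCoord i) h
  have h2 := congrArg (yCoord i) h
  simp [hij.symm] at h1 h2
  exact ⟨h1, h2⟩

/-- The coordinates at the auxiliary index `k` see only the totals; once these coefficients are
known to vanish, those at `i` and `j` isolate the rest. -/
theorem coeff_eq_zero_of_triple {i j k : Fin n} (hij : i ≠ j) (hik : i ≠ k) (hjk : j ≠ k)
    {c₁ c₂ c₃ d₁ d₂ d₃ : ℂ}
    (h : c₁ • xVec i + c₂ • xVec j + c₃ • xTot n + d₁ • yVec i + d₂ • yVec j + d₃ • yTot n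
      = (0 : DoubledSpace n)) :
    c₁ = 0 ∧ c₂ = 0 ∧ c₃ = 0 ∧ d₁ = 0 ∧ d₂ = 0 ∧ d₃ = 0 := by
  have hk := congrArg (xCoord k) h
  have hi := congrArg (xCoord i) h
  have hj := congrArg (xCoord j) h
  have hk' := congrArg (yCoord k) h
  have hi' := congrArg (yCoord i) h
  have hj' := congrArg (yCoord j) h
  simp [hij, hij.symm, hik, hjk] at hk hi hj hk' hi' hj'
  rw [hk] at hi hj
  rw [hk'] at hi' hj'
  exact ⟨by simpa using hi, by simpa using hj, hk, by simpa using hi', by simpa using hj', hk'⟩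

theorem exists_three_distinct (hn : 3 ≤ n) : ∃ i j k : Fin n, i ≠ j ∧ i ≠ k ∧ j ≠ k :=
  ⟨⟨0, by omega⟩, ⟨1, by omega⟩, ⟨2, by omega⟩, by simp, by simp, by simp⟩

theorem jacobi_iff (hn : 3 ≤ n) :
    (∀ u v w, cyclicSum (bracket n p) (bracket n p) u v w = 0) ↔
      FirstObstructionConditions n p := by
  constructor
  · intro h
    obtain ⟨i, j, k, hij, hik, hjk⟩ := exists_three_distinct hn
    have h1 := h (xVec i) (xVec j) (yVec k)
    have h2 := h (xVec k) (yVec i) (yVec j)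
    have h3 := h (xVec i) (xVec j) (yVec i)
    have h4 := h (xVec i) (yVec i) (yVec j)
    rw [jacobi_xxy p hij hik hjk] at h1
    rw [jacobi_xyy p hij hik hjk] at h2
    rw [jacobi_xxy_eq p hij] at h3
    rw [jacobi_xyy_eq p hij] at h4
    obtain ⟨e0, e1⟩ := coeff_eq_zero_of_pair hij h1
    obtain ⟨e2, e3⟩ := coeff_eq_zero_of_pair hij h2
    -- The coefficients come in the order of the vectors, while (I) lists them in another order. All
    -- twelve carry a minus sign except `e9`.
    obtain ⟨e6, e5, e4, e9, e8, e7⟩ := coeff_eq_zero_of_triple hij hik hjk h3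
    obtain ⟨e12, e11, e10, e15, e14, e13⟩ := coeff_eq_zero_of_triple hij hik hjk h4
    rw [neg_eq_zero] at e4 e5 e6 e7 e8 e10 e11 e12 e13 e14 e15
    exact ⟨e0, e1, e2, e3, e4, e5, e6, e7, e8, e9, e10, e11, e12, e13, e14, e15⟩
  · rintro ⟨e0, e1, e2, e3, e4, e5, e6, e7, e8, e9, e10, e11, e12, e13, e14, e15⟩
    apply cyclicSum_eq_zero_of_xy (bracket_swap p) (jacobi_xxx p) (jacobi_yyy p)
    · intro i j k hij hik hjk
      rw [jacobi_xxy p hij hik hjk, e0, e1, zero_smul, zero_smul, add_zero]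
    · intro i j hij
      rw [jacobi_xxy_eq p hij, e4, e5, e6, e7, e8, e9]
      simp
    · intro i j k hij hik hjk
      rw [jacobi_xyy p hij hik hjk, e2, e3, zero_smul, zero_smul, add_zero]
    · intro i j hij
      rw [jacobi_xyy_eq p hij, e10, e11, e12, e13, e14, e15]
      simp

end Jacobi

/-! ### The form at the identity and conditions (II) -/

section SecondObstruction

variable {n : ℕ}

/-- The bilinear form of `κ^C_1`. -/
def pairing (n : ℕ) (α β : ℂ) : DoubledSpace n →ₗ[ℂ] DoubledSpace n →ₗ[ℂ] ℂ :=
  bilinOfTable (xyBasis n) (tableC fun i j => if i = j then α else β)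

theorem toBilin_kappaCOne (α β : ℂ) : toBilin (kappaCOne n α β 1) = pairing n α β := by
  simp [kappaCOne, toBilin_altOfTable, pairing]

variable (α β : ℂ)

theorem pairing_xx (i j : Fin n) : pairing n α β (xVec i) (xVec j) = 0 :=
  bilinOfTable_basis (xyBasis n) _ (Sum.inl i) (Sum.inl j)

theorem pairing_yy (i j : Fin n) : pairing n α β (yVec i) (yVec j) = 0 :=
  bilinOfTable_basis (xyBasis n) _ (Sum.inr i) (Sum.inr j)

theorem pairing_xy (i j : Fin n) :
    pairing n α β (xVec i) (yVec j) = if i = j then α else β :=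
  bilinOfTable_basis (xyBasis n) _ (Sum.inl i) (Sum.inr j)

theorem pairing_yx (i j : Fin n) :
    pairing n α β (yVec i) (xVec j) = -if j = i then α else β :=
  bilinOfTable_basis (xyBasis n) _ (Sum.inr i) (Sum.inl j)

theorem pairing_x_xTot (i : Fin n) : pairing n α β (xVec i) (xTot n) = 0 := by
  simp [xTot, pairing_xx]

theorem pairing_y_yTot (i : Fin n) : pairing n α β (yVec i) (yTot n) = 0 := by
  simp [yTot, pairing_yy]

theorem sum_ite_eq_else (i : Fin n) :
    ∑ j, (if i = j then α else β) = α + (n - 1) * β := by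
  have : ∀ j, (if i = j then α else β) = β + if i = j then α - β else 0 := by
    intro j; split_ifs <;> ring
  simp only [this, Finset.sum_add_distrib, Finset.sum_const, Finset.card_univ, Fintype.card_fin,
    Finset.sum_ite_eq, Finset.mem_univ, if_true, nsmul_eq_mul]
  ring

theorem pairing_x_yTot (i : Fin n) :
    pairing n α β (xVec i) (yTot n) = α + (n - 1) * β := by
  simp only [yTot, map_sum, pairing_xy, sum_ite_eq_else]

theorem pairing_y_xTot (i : Fin n) :
    pairing n α β (yVec i) (xTot n) = -(α + (n - 1) * β) := by
  simp only [xTot, map_sum, pairing_yx, Finset.sum_neg_distrib]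
  rw [← sum_ite_eq_else α β i]
  simp only [eq_comm]

theorem pairing_equivariant (σ : Equiv.Perm (Fin n)) (v w : DoubledSpace n) :
    pairing n α β (doubledPermRep n σ v) (doubledPermRep n σ w) = pairing n α β v w := by
  have : (pairing n α β).compl₁₂ (doubledPermRep n σ) (doubledPermRep n σ) = pairing n α β := by
    apply bilin_ext_xy <;> intro i j <;>
    simp only [LinearMap.compl₁₂_apply, doubledPermRep_xVec, doubledPermRep_yVec, pairing_xx,
      pairing_yy, pairing_xy, pairing_yx, EmbeddingLike.apply_eq_iff_eq]
  exact LinearMap.congr_fun₂ this v w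

variable (p : Params)

/-- For distinct indices everything cancels, so (II) arises only from triples with a repeated index.
-/
theorem cyclicSum_pairing_xxy {i j k : Fin n} (hij : i ≠ j) (hik : i ≠ k) (hjk : j ≠ k) :
    cyclicSum (pairing n α β) (bracket n p) (xVec i) (xVec j) (yVec k) = 0 := by
  simp only [cyclicSum, bracket_xx, bracket_xy, bracket_yx, valXY_of_ne p hik,
    valXY_of_ne p hjk, map_add, map_sub, map_neg, map_smul, pairing_xx, pairing_xy, pairing_yx,
    pairing_yy, pairing_x_xTot, pairing_x_yTot, smul_eq_mul, if_neg hij, if_neg hij.symm,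
    if_neg hik, if_neg hjk]
  ring

theorem cyclicSum_pairing_xyy {i j k : Fin n} (hij : i ≠ j) (hik : i ≠ k) (hjk : j ≠ k) :
    cyclicSum (pairing n α β) (bracket n p) (xVec k) (yVec i) (yVec j) = 0 := by
  simp only [cyclicSum, bracket_yy, bracket_xy, bracket_yx, valXY_of_ne p hik.symm,
    valXY_of_ne p hjk.symm, map_add, map_sub, map_neg, map_smul, pairing_xx, pairing_xy,
    pairing_yx, pairing_yy, pairing_y_xTot, pairing_y_yTot, smul_eq_mul, if_neg hij,
    if_neg hij.symm, if_neg hik.symm, if_neg hjk.symm]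
  ring

theorem cyclicSum_pairing_xxy_eq {i j : Fin n} (hij : i ≠ j) :
    cyclicSum (pairing n α β) (bracket n p) (xVec i) (xVec j) (yVec i)
      = -(α * (p.a₁ - p.b₆ + p.b₄ - p.b₇)
        - β * (p.a₁ - p.b₃ + p.b₅ - (n - 1) * (p.b₄ - p.b₇))) := by
  simp only [cyclicSum, bracket_xx, bracket_xy, bracket_yx, valXY_of_ne p hij.symm,
    valXY_self, map_add, map_sub, map_neg, map_smul, pairing_xx, pairing_xy, pairing_yx,
    pairing_yy, pairing_x_xTot, pairing_x_yTot, smul_eq_mul, if_neg hij, if_neg hij.symm, if_true]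
  ring

theorem cyclicSum_pairing_xyy_eq {i j : Fin n} (hij : i ≠ j) :
    cyclicSum (pairing n α β) (bracket n p) (xVec i) (yVec i) (yVec j)
      = -(α * (-p.b₂ - p.a₅ + p.a₄ - p.a₇)
        + β * (p.b₂ + p.a₃ - p.a₆ + (n - 1) * (p.a₄ - p.a₇))) := by
  simp only [cyclicSum, bracket_yy, bracket_xy, bracket_yx, valXY_of_ne p hij,
    valXY_self, map_add, map_sub, map_neg, map_smul, pairing_xx, pairing_xy, pairing_yx,
    pairing_yy, pairing_y_xTot, pairing_y_yTot, smul_eq_mul, if_neg hij, if_neg hij.symm, if_true]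
  ring

theorem cyclicSum_pairing_iff (hn : 3 ≤ n) :
    (∀ u v w, cyclicSum (pairing n p.α p.β) (bracket n p) u v w = 0) ↔
      SecondObstructionConditionsOne n p := by
  constructor
  · intro h
    obtain ⟨i, j, -, hij, -, -⟩ := exists_three_distinct hn
    have h1 := h (xVec i) (xVec j) (yVec i)
    have h2 := h (xVec i) (yVec i) (yVec j)
    rw [cyclicSum_pairing_xxy_eq _ _ _ hij, neg_eq_zero] at h1
    rw [cyclicSum_pairing_xyy_eq _ _ _ hij, neg_eq_zero] at h2
    exact ⟨h1, h2⟩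
  · rintro ⟨h1, h2⟩
    -- Symmetry of the table in `i, j` makes the sums of type `xxx` and `yyy` cancel in pairs.
    have hs : ∀ i j : Fin n, (if i = j then p.α else p.β) = if j = i then p.α else p.β :=
      fun i j => by simp only [eq_comm]
    apply cyclicSum_eq_zero_of_xy (bracket_swap p)
    · intro i j k
      simp only [cyclicSum, bracket_xx, map_add, map_sub, map_smul, pairing_xx, pairing_xy,
        smul_eq_mul]
      linear_combination p.b₁ * (hs i j + hs j k + hs k i)
    · intro i j k
      simp only [cyclicSum, bracket_yy, map_add, map_sub, map_smul, pairing_yy, pairing_yx,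
        smul_eq_mul]
      linear_combination p.a₂ * (hs i j + hs j k + hs k i)
    · exact fun i j k => cyclicSum_pairing_xxy _ _ p
    · intro i j hij
      rw [cyclicSum_pairing_xxy_eq _ _ _ hij, h1, neg_zero]
    · exact fun i j k => cyclicSum_pairing_xyy _ _ p
    · intro i j hij
      rw [cyclicSum_pairing_xyy_eq _ _ _ hij, h2, neg_zero]

end SecondObstruction

/-! ### The forms at transpositions, conditions (III), and the parameter criterion -/

section Reflections

variable {n : ℕ}

/-- The difference of the coefficients of `x_i` and `x_j`. -/
def xDiff (i j : Fin n) : DoubledSpace n →ₗ[ℂ] ℂ := xCoord i - xCoord j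

/-- The difference of the coefficients of `y_i` and `y_j`. -/
def yDiff (i j : Fin n) : DoubledSpace n →ₗ[ℂ] ℂ := yCoord i - yCoord j

/-- The common value of `xDiff i j` on `x_a` and of `yDiff i j` on `y_a`. -/
def diffSign (i j a : Fin n) : ℂ := (if a = i then 1 else 0) - (if a = j then 1 else 0)

@[simp] theorem xDiff_xVec (i j a : Fin n) : xDiff i j (xVec a) = diffSign i j a := by
  simp [xDiff, diffSign]

@[simp] theorem xDiff_yVec (i j a : Fin n) : xDiff i j (yVec a) = 0 := by simp [xDiff]
@[simp] theorem yDiff_xVec (i j a : Fin n) : yDiff i j (xVec a) = 0 := by simp [yDiff]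

@[simp] theorem yDiff_yVec (i j a : Fin n) : yDiff i j (yVec a) = diffSign i j a := by
  simp [yDiff, diffSign]

@[simp] theorem xDiff_xTot (i j : Fin n) : xDiff i j (xTot n) = 0 := by simp [xDiff]
@[simp] theorem xDiff_yTot (i j : Fin n) : xDiff i j (yTot n) = 0 := by simp [xDiff]
@[simp] theorem yDiff_xTot (i j : Fin n) : yDiff i j (xTot n) = 0 := by simp [yDiff]
@[simp] theorem yDiff_yTot (i j : Fin n) : yDiff i j (yTot n) = 0 := by simp [yDiff]

/-- The bilinear form of `κ^C_ref` at the transposition of `i` and `j`. -/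
def reflForm (c : ℂ) (i j : Fin n) : DoubledSpace n →ₗ[ℂ] DoubledSpace n →ₗ[ℂ] ℂ :=
  c • ((LinearMap.mul ℂ ℂ).compl₁₂ (xDiff i j) (yDiff i j)
    - (LinearMap.mul ℂ ℂ).compl₁₂ (yDiff i j) (xDiff i j))

theorem reflForm_apply (c : ℂ) (i j : Fin n) (u v : DoubledSpace n) :
    reflForm c i j u v = c * (xDiff i j u * yDiff i j v - yDiff i j u * xDiff i j v) := by
  simp [reflForm]

/-- The table has rank one, so the form at the transposition is `c` times the wedge of `xDiff` and
`yDiff`. Both functionals kill `xTot` and `yTot`, which is why `a₄, a₇, b₄, b₇` are absent from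
(III). -/
theorem refl_table_eq (c : ℂ) {i j : Fin n} (hij : i ≠ j) (a b : Fin n) :
    (if Equiv.swap i j a = a then 0 else if b = a then c
      else if b = Equiv.swap i j a then -c else 0) = c * (diffSign i j a * diffSign i j b) := by
  by_cases hai : a = i
  · subst hai
    by_cases hba : b = a
    · subst hba; simp [diffSign, hij, hij.symm]
    · by_cases hbj : b = j
      · subst hbj; simp [diffSign, hij, hij.symm]
      · simp [diffSign, hij, hij.symm, hba, hbj]
  · by_cases haj : a = j
    · subst haj
      by_cases hba : b = a
      · subst hba; simp [diffSign, hij, hij.symm]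
      · by_cases hbi : b = i
        · subst hbi; simp [diffSign, hij, hij.symm]
        · simp [diffSign, hij, hij.symm, hba, hbi]
    · simp [diffSign, hai, haj, Equiv.swap_apply_of_ne_of_ne]

theorem toBilin_kappaCRefl_swap (c : ℂ) {i j : Fin n} (hij : i ≠ j) :
    toBilin (kappaCRefl n c (Equiv.swap i j)) = reflForm c i j := by
  have hs : (Equiv.swap i j).IsSwap := ⟨i, j, hij, rfl⟩
  rw [kappaCRefl, if_pos hs, toBilin_altOfTable]
  apply bilin_ext_xy <;> intro a b
  · exact (bilinOfTable_basis (xyBasis n) _ (Sum.inl a) (Sum.inl b)).trans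
      (by simp [tableC, reflForm_apply])
  · exact (bilinOfTable_basis (xyBasis n) _ (Sum.inl a) (Sum.inr b)).trans
      (by simpa [tableC, reflForm_apply] using refl_table_eq c hij a b)
  · refine (bilinOfTable_basis (xyBasis n) _ (Sum.inr a) (Sum.inl b)).trans ?_
    simp only [tableC, reflForm_apply, refl_table_eq c hij b a, xDiff_yVec, yDiff_yVec,
      xDiff_xVec, yDiff_xVec]
    ring
  · exact (bilinOfTable_basis (xyBasis n) _ (Sum.inr a) (Sum.inr b)).trans
      (by simp [tableC, reflForm_apply])

theorem kappaCRefl_of_not_isSwap (c : ℂ) {g : Equiv.Perm (Fin n)} (hg : ¬ g.IsSwap) :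
    kappaCRefl n c g = 0 := by
  rw [kappaCRefl, if_neg hg]

theorem not_isSwap_one : ¬ (1 : Equiv.Perm (Fin n)).IsSwap := by
  rintro ⟨i, j, hij, h⟩
  exact hij (Equiv.swap_eq_one_iff.mp h.symm)

theorem kappaCRefl_zero : kappaCRefl n 0 = 0 := by
  funext g
  by_cases hg : g.IsSwap
  · obtain ⟨i, j, hij, rfl⟩ := hg
    apply toBilin_injective
    rw [toBilin_kappaCRefl_swap 0 hij]
    simp [reflForm]
  · exact kappaCRefl_of_not_isSwap 0 hg

theorem reflForm_equivariant (c : ℂ) (i j : Fin n) (σ : Equiv.Perm (Fin n))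
    (u v : DoubledSpace n) :
    reflForm c (σ i) (σ j) (doubledPermRep n σ u) (doubledPermRep n σ v)
      = reflForm c i j u v := by
  simp only [reflForm_apply, xDiff, yDiff, LinearMap.sub_apply, xCoord_doubledPermRep,
    yCoord_doubledPermRep]

theorem conj_swap (σ : Equiv.Perm (Fin n)) (i j : Fin n) :
    σ * Equiv.swap i j * σ⁻¹ = Equiv.swap (σ i) (σ j) := by
  rw [Equiv.mul_swap_eq_swap_mul, mul_assoc, mul_inv_cancel, mul_one]

theorem isSwap_conj_iff (σ g : Equiv.Perm (Fin n)) : (σ * g * σ⁻¹).IsSwap ↔ g.IsSwap := by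
  have key : ∀ σ g : Equiv.Perm (Fin n), g.IsSwap → (σ * g * σ⁻¹).IsSwap := by
    rintro σ _ ⟨i, j, hij, rfl⟩
    exact ⟨σ i, σ j, σ.injective.ne hij, conj_swap σ i j⟩
  refine ⟨fun h => ?_, key σ g⟩
  have := key σ⁻¹ _ h
  rwa [show σ⁻¹ * (σ * g * σ⁻¹) * σ⁻¹⁻¹ = g by group] at this

theorem kappaCRefl_invariant (c : ℂ) :
    IsInvariantConst (doubledPermRep n) (kappaCRefl n c) := by
  intro g h v w
  by_cases hg : g.IsSwap
  · obtain ⟨i, j, hij, rfl⟩ := hg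
    rw [conj_swap, ← toBilin_apply, ← toBilin_apply, toBilin_kappaCRefl_swap c hij,
      toBilin_kappaCRefl_swap c (h.injective.ne hij), reflForm_equivariant]
  · rw [kappaCRefl_of_not_isSwap c hg,
      kappaCRefl_of_not_isSwap c (mt (isSwap_conj_iff h g).mp hg)]
    rfl

theorem kappaCOne_invariant (α β : ℂ) :
    IsInvariantConst (doubledPermRep n) (kappaCOne n α β) := by
  intro g h v w
  by_cases hg : g = 1
  · subst hg
    rw [mul_one, mul_inv_cancel, ← toBilin_apply, ← toBilin_apply, toBilin_kappaCOne,
      pairing_equivariant]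
  · have : h * g * h⁻¹ ≠ 1 := by simpa using hg
    simp [kappaCOne, hg]

theorem kappaC_one (α β c : ℂ) :
    (kappaCOne n α β + kappaCRefl n c) 1 = kappaCOne n α β 1 := by
  rw [Pi.add_apply, kappaCRefl_of_not_isSwap c not_isSwap_one, add_zero]

theorem kappaC_of_ne_one (α β c : ℂ) {g : Equiv.Perm (Fin n)} (hg : g ≠ 1) :
    (kappaCOne n α β + kappaCRefl n c) g = kappaCRefl n c g := by
  rw [Pi.add_apply, kappaCOne, if_neg hg, zero_add]

theorem doubledPermRep_swap_sub {i j : Fin n} (v : DoubledSpace n) :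
    doubledPermRep n (Equiv.swap i j) v - v
      = -(xDiff i j v • (xVec i - xVec j) + yDiff i j v • (yVec i - yVec j)) := by
  have key : ∀ a : Fin n, Equiv.swap i j a = a ∧ diffSign i j a = 0 ∨
      a = i ∧ Equiv.swap i j a = j ∧ diffSign i j a = 1 ∨
      a = j ∧ Equiv.swap i j a = i ∧ diffSign i j a = -1 := by
    intro a
    by_cases hij : i = j
    · subst hij; left; simp [diffSign]
    by_cases hai : a = i
    · subst hai; right; left; simp [diffSign, hij]
    by_cases haj : a = j
    · subst haj; right; right; simp [diffSign, hai]
    · left; simp [diffSign, hai, haj, Equiv.swap_apply_of_ne_of_ne]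
  have : doubledPermRep n (Equiv.swap i j) - LinearMap.id
      = -((xDiff i j).smulRight (xVec i - xVec j) + (yDiff i j).smulRight (yVec i - yVec j)) := by
    apply linearMap_ext_xy <;> intro a <;>
    simp only [LinearMap.sub_apply, LinearMap.id_apply, LinearMap.neg_apply, LinearMap.add_apply,
      LinearMap.smulRight_apply, doubledPermRep_xVec, doubledPermRep_yVec, xDiff_xVec, xDiff_yVec,
      yDiff_xVec, yDiff_yVec] <;>
    rcases key a with ⟨h1, h2⟩ | ⟨h0, h1, h2⟩ | ⟨h0, h1, h2⟩ <;> rw [h1, h2] <;>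
    first | module | (rw [h0]; module)
  exact LinearMap.congr_fun this v

/-- At a transposition both the form and `g - 1` are built from the two functionals `xDiff` and
`yDiff`. Each coefficient of `ψ` is a wedge of three functionals taken from these two, hence zero.
-/
theorem psiConst_kappaC (α β c : ℂ) {g : Equiv.Perm (Fin n)} (hg : g ≠ 1)
    (v₁ v₂ v₃ : DoubledSpace n) :
    psiConst (doubledPermRep n) (kappaCOne n α β + kappaCRefl n c) g v₁ v₂ v₃ = 0 := by
  simp only [psiConst, kappaC_of_ne_one α β c hg]
  by_cases hs : g.IsSwap
  · obtain ⟨i, j, hij, rfl⟩ := hs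
    simp only [← toBilin_apply, toBilin_kappaCRefl_swap c hij, reflForm_apply,
      doubledPermRep_swap_sub]
    module
  · simp [kappaCRefl_of_not_isSwap c hs]

theorem cyclicSum_refl_iff (hn : 3 ≤ n) (p : Params) :
    (∀ i j : Fin n, i ≠ j → ∀ u v w,
      cyclicSum (reflForm p.c i j) (bracket n p) u v w = 0) ↔
      SecondObstructionConditionsRefl p := by
  have hxxy : ∀ i j a b d : Fin n, a ≠ b → a ≠ d → b ≠ d →
      cyclicSum (reflForm p.c i j) (bracket n p) (xVec a) (xVec b) (yVec d)
        = -(diffSign i j d * (diffSign i j a - diffSign i j b)) * (p.c * (p.a₁ - p.b₆)) := by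
    intro i j a b d hab had hbd
    simp only [cyclicSum, bracket_xx, bracket_xy, bracket_yx, valXY_of_ne p had,
      valXY_of_ne p hbd, map_add, map_sub, map_neg, map_smul, reflForm_apply, xDiff_xVec,
      xDiff_yVec, yDiff_xVec, yDiff_yVec, xDiff_xTot, xDiff_yTot, yDiff_xTot, yDiff_yTot,
      smul_eq_mul]
    ring
  have hxyy : ∀ i j a b d : Fin n, a ≠ b → a ≠ d → b ≠ d →
      cyclicSum (reflForm p.c i j) (bracket n p) (xVec d) (yVec a) (yVec b)
        = diffSign i j d * (diffSign i j a - diffSign i j b) * (p.c * (p.a₅ + p.b₂)) := by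
    intro i j a b d hab had hbd
    simp only [cyclicSum, bracket_yy, bracket_xy, bracket_yx, valXY_of_ne p had.symm,
      valXY_of_ne p hbd.symm, map_add, map_sub, map_neg, map_smul, reflForm_apply, xDiff_xVec,
      xDiff_yVec, yDiff_xVec, yDiff_yVec, xDiff_xTot, xDiff_yTot, yDiff_xTot, yDiff_yTot,
      smul_eq_mul]
    ring
  have hxxy' : ∀ i j a b : Fin n, a ≠ b →
      cyclicSum (reflForm p.c i j) (bracket n p) (xVec a) (xVec b) (yVec a)
        = diffSign i j a * diffSign i j b * (p.c * (2 * p.a₁ - p.b₃ + p.b₅ - p.b₆))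
          - (diffSign i j a ^ 2 + diffSign i j a * diffSign i j b) * (p.c * (p.a₁ - p.b₆)) := by
    intro i j a b hab
    simp only [cyclicSum, bracket_xx, bracket_xy, bracket_yx, valXY_of_ne p hab.symm,
      valXY_self, map_add, map_sub, map_neg, map_smul, reflForm_apply, xDiff_xVec,
      xDiff_yVec, yDiff_xVec, yDiff_yVec, xDiff_xTot, xDiff_yTot, yDiff_xTot, yDiff_yTot,
      smul_eq_mul]
    ring
  have hxyy' : ∀ i j a b : Fin n, a ≠ b →
      cyclicSum (reflForm p.c i j) (bracket n p) (xVec a) (yVec a) (yVec b)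
        = -(diffSign i j a * diffSign i j b) * (p.c * (2 * p.b₂ + p.a₃ + p.a₅ - p.a₆))
          + (diffSign i j a ^ 2 + diffSign i j a * diffSign i j b) * (p.c * (p.a₅ + p.b₂)) := by
    intro i j a b hab
    simp only [cyclicSum, bracket_yy, bracket_xy, bracket_yx, valXY_of_ne p hab,
      valXY_self, map_add, map_sub, map_neg, map_smul, reflForm_apply, xDiff_xVec,
      xDiff_yVec, yDiff_xVec, yDiff_yVec, xDiff_xTot, xDiff_yTot, yDiff_xTot, yDiff_yTot,
      smul_eq_mul]
    ring
  constructor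
  · intro h
    -- The signs at `i, j, k` are `1, -1, 0`. On the pair `i, j` the factor `diffSign ^ 2 + diffSign
    -- * diffSign` vanishes, so each test triple isolates one relation.
    obtain ⟨i, j, k, hij, hik, hjk⟩ := exists_three_distinct hn
    have hi : diffSign i j i = 1 := by simp [diffSign, hij]
    have hj : diffSign i j j = -1 := by simp [diffSign, hij.symm]
    have hk : diffSign i j k = 0 := by simp [diffSign, hik.symm, hjk.symm]
    have h1 := h i j hij (xVec i) (xVec k) (yVec j)
    have h2 := h i j hij (xVec i) (xVec j) (yVec i)
    have h3 := h i j hij (xVec j) (yVec i) (yVec k)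
    have h4 := h i j hij (xVec i) (yVec i) (yVec j)
    rw [hxxy i j i k j hik hij hjk.symm, hi, hj, hk] at h1
    rw [hxxy' i j i j hij, hi, hj] at h2
    rw [hxyy i j i k j hik hij hjk.symm, hi, hj, hk] at h3
    rw [hxyy' i j i j hij, hi, hj] at h4
    refine ⟨?_, ?_, ?_, ?_⟩
    · linear_combination h1
    · linear_combination -h2
    · linear_combination -h3
    · linear_combination h4
  · rintro ⟨h1, h2, h3, h4⟩ i j hij
    apply cyclicSum_eq_zero_of_xy (bracket_swap p)
    · intro a b d
      simp only [cyclicSum, bracket_xx, map_add, map_sub, map_smul, reflForm_apply, xDiff_xVec,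
        xDiff_yVec, yDiff_xVec, yDiff_yVec, smul_eq_mul]
      ring
    · intro a b d
      simp only [cyclicSum, bracket_yy, map_add, map_sub, map_smul, reflForm_apply, xDiff_xVec,
        xDiff_yVec, yDiff_xVec, yDiff_yVec, smul_eq_mul]
      ring
    · intro a b d hab had hbd
      rw [hxxy i j a b d hab had hbd, h1, mul_zero]
    · intro a b hab
      rw [hxxy' i j a b hab, h1, h2]; ring
    · intro a b d hab had hbd
      rw [hxyy i j a b d hab had hbd, h3, mul_zero]
    · intro a b hab
      rw [hxyy' i j a b hab, h3, h4]; ring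

/-- For each choice of the parameters, `κ^L_1 + κ^C_1 + κ^C_ref` is a Lie orbifold algebra map if
and only if the quadratic relations hold. -/
theorem isLieOrbifoldAlgebraMap_kappa_iff (hn : 3 ≤ n) (p : Params) :
    IsLieOrbifoldAlgebraMap (doubledPermRep n) (kappaLOne n p)
      (kappaCOne n p.α p.β + kappaCRefl n p.c) ↔ LieOrbifoldConditions n p := by
  have hinv : IsInvariantConst (doubledPermRep n) (kappaCOne n p.α p.β + kappaCRefl n p.c) := by
    intro g h v w
    have h1 := kappaCOne_invariant p.α p.β g h v w
    have h2 := kappaCRefl_invariant p.c g h v w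
    simp only [Pi.add_apply, AlternatingMap.add_apply, h1, h2]
  rw [isLieOrbifoldAlgebraMap_iff, LieOrbifoldConditions, ← jacobi_iff p hn,
    ← cyclicSum_pairing_iff p hn, ← cyclicSum_refl_iff hn p, toBilin_kappaLOne]
  constructor
  · rintro ⟨-, -, -, -, hJ, hK⟩
    refine ⟨hJ, fun u v w => ?_, fun i j hij u v w => ?_⟩
    · have := hK 1 u v w
      rwa [kappaC_one, toBilin_kappaCOne] at this
    · have := hK (Equiv.swap i j) u v w
      rwa [kappaC_of_ne_one _ _ _ (mt Equiv.swap_eq_one_iff.mp hij),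
        toBilin_kappaCRefl_swap p.c hij] at this
  · rintro ⟨hJ, hK, hR⟩
    refine ⟨fun g hg => by rw [kappaLOne, if_neg hg], kappaLOne_invariant p, hinv,
      fun g hg => psiConst_kappaC _ _ _ hg, hJ, fun g u v w => ?_⟩
    by_cases hg : g = 1
    · subst hg
      rw [kappaC_one, toBilin_kappaCOne, hK]
    · rw [kappaC_of_ne_one _ _ _ hg]
      by_cases hs : g.IsSwap
      · obtain ⟨i, j, hij, rfl⟩ := hs
        rw [toBilin_kappaCRefl_swap p.c hij, hR i j hij]
      · rw [kappaCRefl_of_not_isSwap p.c hs]; simp [cyclicSum]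

end Reflections

/-! ### Equivariant brackets and invariant forms -/

section Invariants

variable {n : ℕ}

theorem exists_perm_two {a b i j : Fin n} (hab : a ≠ b) (hij : i ≠ j) :
    ∃ σ : Equiv.Perm (Fin n), σ a = i ∧ σ b = j := by
  -- The first swap sends `a` to `i`; the second moves the image of `b` to `j` and leaves `i` alone.
  refine ⟨Equiv.swap (Equiv.swap a i b) j * Equiv.swap a i, ?_, ?_⟩
  · have h : i ≠ Equiv.swap a i b := fun h => hab <| (Equiv.swap a i).injective (by simpa using h)
    rw [Equiv.Perm.mul_apply, Equiv.swap_apply_left, Equiv.swap_apply_of_ne_of_ne h hij]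
  · simp

theorem exists_perm_three {a b c i j k : Fin n} (hab : a ≠ b) (hac : a ≠ c) (hbc : b ≠ c)
    (hij : i ≠ j) (hik : i ≠ k) (hjk : j ≠ k) :
    ∃ σ : Equiv.Perm (Fin n), σ a = i ∧ σ b = j ∧ σ c = k := by
  obtain ⟨τ, h1, h2⟩ := exists_perm_two hab hij
  refine ⟨Equiv.swap (τ c) k * τ, ?_, ?_, by simp⟩
  · rw [Equiv.Perm.mul_apply, h1, Equiv.swap_apply_of_ne_of_ne (h1 ▸ τ.injective.ne hac) hik]
  · rw [Equiv.Perm.mul_apply, h2, Equiv.swap_apply_of_ne_of_ne (h2 ▸ τ.injective.ne hbc) hjk]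

/-- A function of three indices invariant under all permutations depends only on the coincidences
among the indices. -/
theorem exists_coeff_of_invariant (hn : 3 ≤ n) {F : Fin n → Fin n → Fin n → ℂ}
    (hF : ∀ (σ : Equiv.Perm (Fin n)) i j m, F (σ i) (σ j) (σ m) = F i j m) :
    ∃ a b c d e : ℂ,
      (∀ i j m, i ≠ j → F i j m = a * (if i = m then 1 else 0) + b * (if j = m then 1 else 0) + c) ∧
      ∀ i m, F i i m = d * (if i = m then 1 else 0) + e := by
  obtain ⟨x, y, z, hxy, hxz, hyz⟩ := exists_three_distinct hn
  -- One value for each of the five orbits of triples; the value at an index `m` distinct from the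
  -- others is the constant term, and is subtracted from the rest.
  refine ⟨F x y x - F x y z, F x y y - F x y z, F x y z, F x x x - F x x y, F x x y, ?_, ?_⟩
  · intro i j m hij
    obtain ⟨σ, rfl, rfl⟩ := exists_perm_two hxy hij
    by_cases him : σ x = m
    · subst him; rw [hF, if_pos rfl, if_neg hij.symm]; ring
    by_cases hjm : σ y = m
    · subst hjm; rw [hF, if_pos rfl, if_neg hij]; ring
    · obtain ⟨τ, h1, h2, h3⟩ := exists_perm_three hxy hxz hyz hij him hjm
      rw [if_neg him, if_neg hjm, ← h1, ← h2, ← h3, hF]; ring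
  · intro i m
    by_cases him : i = m
    · subst him
      obtain ⟨σ, rfl, -⟩ := exists_perm_two hxy (show i ≠ Equiv.swap x i y from fun h =>
        hxy ((Equiv.swap x i).injective (by simpa using h)))
      rw [hF, if_pos rfl]; ring
    · obtain ⟨σ, rfl, rfl⟩ := exists_perm_two hxy him
      rw [hF, if_neg him]; ring

theorem exists_coeff_of_invariant_skew (hn : 3 ≤ n) {F : Fin n → Fin n → Fin n → ℂ}
    (hF : ∀ (σ : Equiv.Perm (Fin n)) i j m, F (σ i) (σ j) (σ m) = F i j m)
    (hskew : ∀ i j m, F i j m = -F j i m) :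
    ∃ a : ℂ, ∀ i j m, F i j m = a * ((if i = m then 1 else 0) - (if j = m then 1 else 0)) := by
  obtain ⟨a, b, c, d, e, h1, -⟩ := exists_coeff_of_invariant hn hF
  obtain ⟨x, y, z, hxy, hxz, hyz⟩ := exists_three_distinct hn
  have hz := hskew x y z
  have hx := hskew x y x
  rw [h1 _ _ _ hxy, h1 _ _ _ hxy.symm] at hz hx
  simp only [if_neg hxz, if_neg hyz, if_neg hxy.symm, if_true] at hz hx
  refine ⟨a, fun i j m => ?_⟩
  by_cases hij : i = j
  · subst hij
    rw [sub_self, mul_zero]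
    exact self_eq_neg.mp (hskew i i m)
  · rw [h1 _ _ _ hij]
    -- Here `hz` says `2c = 0` and `hx` says `a + b + 2c = 0`, so that `c = 0` and `b = -a`.
    linear_combination (1 / 2 - (if j = m then 1 else 0)) * hz + (if j = m then 1 else 0) * hx

/-- The equivariant alternating bilinear maps `V × V → V`. -/
theorem exists_params_of_equivariant (hn : 3 ≤ n)
    {L : DoubledSpace n →ₗ[ℂ] DoubledSpace n →ₗ[ℂ] DoubledSpace n}
    (hskew : ∀ v w, L v w = -L w v)
    (hL : ∀ (σ : Equiv.Perm (Fin n)) v w,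
      doubledPermRep n σ (L v w) = L (doubledPermRep n σ v) (doubledPermRep n σ w))
    (α β c : ℂ) : ∃ p : Params, p.α = α ∧ p.β = β ∧ p.c = c ∧ L = bracket n p := by
  have hx : ∀ (σ : Equiv.Perm (Fin n)) (m : Fin n) (v w : DoubledSpace n),
      xCoord (σ m) (L (doubledPermRep n σ v) (doubledPermRep n σ w)) = xCoord m (L v w) :=
    fun σ m v w => by rw [← hL, xCoord_doubledPermRep]
  have hy : ∀ (σ : Equiv.Perm (Fin n)) (m : Fin n) (v w : DoubledSpace n),
      yCoord (σ m) (L (doubledPermRep n σ v) (doubledPermRep n σ w)) = yCoord m (L v w) :=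
    fun σ m v w => by rw [← hL, yCoord_doubledPermRep]
  obtain ⟨a₁, h1⟩ := exists_coeff_of_invariant_skew hn
    (F := fun i j m => xCoord m (L (xVec i) (xVec j)))
    (fun σ i j m => by simpa only [doubledPermRep_xVec] using hx σ m (xVec i) (xVec j))
    (fun i j m => by rw [hskew, map_neg])
  obtain ⟨b₁, h2⟩ := exists_coeff_of_invariant_skew hn
    (F := fun i j m => yCoord m (L (xVec i) (xVec j)))
    (fun σ i j m => by simpa only [doubledPermRep_xVec] using hy σ m (xVec i) (xVec j))
    (fun i j m => by rw [hskew, map_neg])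
  obtain ⟨a₂, h3⟩ := exists_coeff_of_invariant_skew hn
    (F := fun i j m => xCoord m (L (yVec i) (yVec j)))
    (fun σ i j m => by simpa only [doubledPermRep_yVec] using hx σ m (yVec i) (yVec j))
    (fun i j m => by rw [hskew, map_neg])
  obtain ⟨b₂, h4⟩ := exists_coeff_of_invariant_skew hn
    (F := fun i j m => yCoord m (L (yVec i) (yVec j)))
    (fun σ i j m => by simpa only [doubledPermRep_yVec] using hy σ m (yVec i) (yVec j))
    (fun i j m => by rw [hskew, map_neg])
  -- The constant terms `a₇` and `a₄` are coefficients of `xTot`, each of whose coordinates is `1`.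
  obtain ⟨a₅, a₆, a₇, a₃, a₄, h5, h6⟩ := exists_coeff_of_invariant hn
    (F := fun i j m => xCoord m (L (xVec i) (yVec j)))
    (fun σ i j m => by
      simpa only [doubledPermRep_xVec, doubledPermRep_yVec] using hx σ m (xVec i) (yVec j))
  obtain ⟨b₅, b₆, b₇, b₃, b₄, h7, h8⟩ := exists_coeff_of_invariant hn
    (F := fun i j m => yCoord m (L (xVec i) (yVec j)))
    (fun σ i j m => by
      simpa only [doubledPermRep_xVec, doubledPermRep_yVec] using hy σ m (xVec i) (yVec j))
  refine ⟨⟨a₁, a₂, a₃, a₄, a₅, a₆, a₇, b₁, b₂, b₃, b₄, b₅, b₆, b₇, α, β, c⟩, rfl, rfl, rfl, ?_⟩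
  have hxy : ∀ i j, L (xVec i) (yVec j)
      = valXY ⟨a₁, a₂, a₃, a₄, a₅, a₆, a₇, b₁, b₂, b₃, b₄, b₅, b₆, b₇, α, β, c⟩ i j := by
    intro i j
    by_cases hij : i = j
    · subst hij
      rw [valXY_self]
      apply ext_coord <;> intro m
      · rw [h6]; simp
      · rw [h8]; simp
    · rw [valXY_of_ne _ hij]
      apply ext_coord <;> intro m
      · rw [h5 i j m hij]; simp
      · rw [h7 i j m hij]; simp
  apply bilin_ext_xy <;> intro i j
  · rw [bracket_xx]
    apply ext_coord <;> intro m
    · rw [h1]; simp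
    · rw [h2]; simp
  · rw [bracket_xy, hxy]
  · rw [bracket_yx, hskew, hxy]
  · rw [bracket_yy]
    apply ext_coord <;> intro m
    · rw [h3]; simp
    · rw [h4]; simp

theorem exists_pairing_of_invariant (hn : 3 ≤ n)
    {K : DoubledSpace n →ₗ[ℂ] DoubledSpace n →ₗ[ℂ] ℂ} (hskew : ∀ v w, K v w = -K w v)
    (hK : ∀ (σ : Equiv.Perm (Fin n)) v w,
      K (doubledPermRep n σ v) (doubledPermRep n σ w) = K v w) :
    ∃ α β : ℂ, K = pairing n α β := by
  obtain ⟨x, y, -, hxy, -, -⟩ := exists_three_distinct hn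
  have hKxy : ∀ i j, K (xVec i) (yVec j)
      = if i = j then K (xVec x) (yVec x) else K (xVec x) (yVec y) := by
    intro i j
    by_cases hij : i = j
    · subst hij
      have := hK (Equiv.swap x i) (xVec x) (yVec x)
      rw [doubledPermRep_xVec, doubledPermRep_yVec, Equiv.swap_apply_left] at this
      rw [if_pos rfl]; exact this
    · obtain ⟨σ, rfl, rfl⟩ := exists_perm_two hxy hij
      rw [if_neg hij, ← doubledPermRep_xVec, ← doubledPermRep_yVec, hK]
  refine ⟨K (xVec x) (yVec x), K (xVec x) (yVec y), ?_⟩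
  apply bilin_ext_xy <;> intro i j
  · rw [pairing_xx]
    -- Invariance under the swap makes the values symmetric in `i, j`; being skew as well, they
    -- vanish.
    have := hK (Equiv.swap i j) (xVec i) (xVec j)
    rw [doubledPermRep_xVec, doubledPermRep_xVec, Equiv.swap_apply_left,
      Equiv.swap_apply_right, hskew] at this
    exact self_eq_neg.mp this.symm
  · rw [pairing_xy, hKxy]
  · rw [pairing_yx, hskew, hKxy]
  · rw [pairing_yy]
    have := hK (Equiv.swap i j) (yVec i) (yVec j)
    rw [doubledPermRep_yVec, doubledPermRep_yVec, Equiv.swap_apply_left,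
      Equiv.swap_apply_right, hskew] at this
    exact self_eq_neg.mp this.symm

end Invariants

/-! ### Constant cochains with `ψ = 0`: support on transpositions -/

section Support

variable {n : ℕ}

/-- The condition `ψ(κ)_g = 0` for a constant cochain `κ` whose `g`-component has the bilinear
form `K`. -/
def PsiVanishes (g : Equiv.Perm (Fin n)) (K : DoubledSpace n →ₗ[ℂ] DoubledSpace n →ₗ[ℂ] ℂ) :
    Prop :=
  ∀ u v w, K u v • (doubledPermRep n g w - w) + K v w • (doubledPermRep n g u - u)
    + K w u • (doubledPermRep n g v - v) = 0

variable {g : Equiv.Perm (Fin n)} {K : DoubledSpace n →ₗ[ℂ] DoubledSpace n →ₗ[ℂ] ℂ}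

theorem exists_moved (hg : g ≠ 1) : ∃ d, g d ≠ d := by
  by_contra! h
  exact hg (Equiv.ext h)

/-- Against `y_d` with `d` moved by `g`, only this value multiplies a vector with nonzero
`y`-coordinates. -/
theorem PsiVanishes.form_xx (hψ : PsiVanishes g K) (hg : g ≠ 1) (a b : Fin n) :
    K (xVec a) (xVec b) = 0 := by
  obtain ⟨d, hd⟩ := exists_moved hg
  have := congrArg (yCoord (g d)) (hψ (xVec a) (xVec b) (yVec d))
  simpa [doubledPermRep_xVec, doubledPermRep_yVec, hd.symm] using this

theorem PsiVanishes.form_yy (hψ : PsiVanishes g K) (hg : g ≠ 1) (a b : Fin n) :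
    K (yVec a) (yVec b) = 0 := by
  obtain ⟨d, hd⟩ := exists_moved hg
  have := congrArg (xCoord (g d)) (hψ (yVec a) (yVec b) (xVec d))
  simpa [doubledPermRep_xVec, doubledPermRep_yVec, hd.symm] using this

/-- If the form is nonzero on some `x_b, y_d`, every `(g - 1) x_a` is a multiple of `(g - 1) x_b`.
This rank constraint on `g` drives the rest of the section. -/
theorem PsiVanishes.relation_x (hψ : PsiVanishes g K) (hg : g ≠ 1)
    (hskew : ∀ v w, K v w = -K w v) (a b d : Fin n) :
    K (xVec b) (yVec d) • (xVec (g a) - xVec a) = K (xVec a) (yVec d) • (xVec (g b) - xVec b) := by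
  have := hψ (xVec a) (xVec b) (yVec d)
  rw [hψ.form_xx hg, hskew (yVec d), zero_smul, zero_add, doubledPermRep_xVec,
    doubledPermRep_xVec, neg_smul, ← sub_eq_add_neg] at this
  exact sub_eq_zero.mp this

theorem PsiVanishes.relation_y (hψ : PsiVanishes g K) (hg : g ≠ 1)
    (hskew : ∀ v w, K v w = -K w v) (a b d : Fin n) :
    K (xVec b) (yVec a) • (yVec (g d) - yVec d) = K (xVec b) (yVec d) • (yVec (g a) - yVec a) := by
  have := hψ (xVec b) (yVec a) (yVec d)
  rw [hψ.form_yy hg, hskew (yVec d), zero_smul, add_zero, doubledPermRep_yVec,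
    doubledPermRep_yVec, neg_smul, ← sub_eq_add_neg] at this
  exact sub_eq_zero.mp this

theorem PsiVanishes.form_xy_of_left_fixed (hψ : PsiVanishes g K) (hg : g ≠ 1)
    (hskew : ∀ v w, K v w = -K w v) {b : Fin n} (hb : g b = b) (d : Fin n) :
    K (xVec b) (yVec d) = 0 := by
  obtain ⟨a, ha⟩ := exists_moved hg
  have := congrArg (xCoord (g a)) (hψ.relation_x hg hskew a b d)
  simpa [hb, ha.symm] using this

theorem PsiVanishes.form_xy_of_right_fixed (hψ : PsiVanishes g K) (hg : g ≠ 1)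
    (hskew : ∀ v w, K v w = -K w v) {d : Fin n} (hd : g d = d) (b : Fin n) :
    K (xVec b) (yVec d) = 0 := by
  obtain ⟨a, ha⟩ := exists_moved hg
  have := congrArg (yCoord (g a)) (hψ.relation_y hg hskew a b d)
  simpa [hd, ha.symm] using this.symm

/-- A non-identity permutation with `g - 1` of rank one on `W*` is a transposition. For `b` moved by
`g`, either `g (g b) ≠ b` and the index `g b` violates proportionality, or `b, g b` form a 2-cycle
and another moved index does. -/
theorem PsiVanishes.form_eq_zero (hψ : PsiVanishes g K) (hg : g ≠ 1)
    (hskew : ∀ v w, K v w = -K w v) (hs : ¬ g.IsSwap) : K = 0 := by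
  have hxy : ∀ b d, K (xVec b) (yVec d) = 0 := by
    intro b d
    by_cases hb : g b = b
    · exact hψ.form_xy_of_left_fixed hg hskew hb d
    by_cases hbb : g (g b) = b
    · obtain ⟨a, hab, hagb, ha⟩ : ∃ a, a ≠ b ∧ a ≠ g b ∧ g a ≠ a := by
        by_contra! h
        refine hs ⟨b, g b, Ne.symm hb, Equiv.ext fun a => ?_⟩
        by_cases hab : a = b
        · rw [hab, Equiv.swap_apply_left]
        by_cases hagb : a = g b
        · rw [hagb, Equiv.swap_apply_right, hbb]
        · rw [Equiv.swap_apply_of_ne_of_ne hab hagb, h a hab hagb]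
      have := congrArg (xCoord a) (hψ.relation_x hg hskew a b d)
      simpa [ha, hab.symm, hagb.symm] using this
    · have := congrArg (xCoord (g (g b))) (hψ.relation_x hg hskew (g b) b d)
      simpa [Ne.symm hbb, g.injective.ne hb, Ne.symm hb, hb] using this
  apply bilin_ext_xy <;> intro i j <;> simp only [LinearMap.zero_apply]
  · exact hψ.form_xx hg i j
  · exact hxy i j
  · rw [hskew, hxy, neg_zero]
  · exact hψ.form_yy hg i j

theorem PsiVanishes.form_eq_reflForm {i j : Fin n} (hij : i ≠ j)
    (hψ : PsiVanishes (Equiv.swap i j) K) (hskew : ∀ v w, K v w = -K w v) :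
    K = reflForm (K (xVec i) (yVec i)) i j := by
  have hg : Equiv.swap i j ≠ 1 := mt Equiv.swap_eq_one_iff.mp hij
  have hx : ∀ d, K (xVec j) (yVec d) = -K (xVec i) (yVec d) := by
    intro d
    have := congrArg (xCoord j) (hψ.relation_x hg hskew j i d)
    simpa [hij] using this.symm
  have hy : ∀ b, K (xVec b) (yVec j) = -K (xVec b) (yVec i) := by
    intro b
    have := congrArg (yCoord i) (hψ.relation_y hg hskew i b j)
    simpa [hij.symm, neg_eq_iff_eq_neg] using this.symm
  have hi : diffSign i j i = 1 := by simp [diffSign, hij]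
  have hj : diffSign i j j = -1 := by simp [diffSign, hij.symm]
  have hxi : ∀ b, K (xVec i) (yVec b) = K (xVec i) (yVec i) * diffSign i j b := by
    intro b
    by_cases hbi : b = i
    · rw [hbi, hi, mul_one]
    by_cases hbj : b = j
    · rw [hbj, hj, hy]; ring
    · rw [hψ.form_xy_of_right_fixed hg hskew (Equiv.swap_apply_of_ne_of_ne hbi hbj)]
      simp [diffSign, hbi, hbj]
  have hxy : ∀ a b, K (xVec a) (yVec b)
      = K (xVec i) (yVec i) * (diffSign i j a * diffSign i j b) := by
    intro a b
    by_cases hai : a = i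
    · rw [hai, hi, hxi]; ring
    by_cases haj : a = j
    · rw [haj, hj, hx, hxi]; ring
    · rw [hψ.form_xy_of_left_fixed hg hskew (Equiv.swap_apply_of_ne_of_ne hai haj)]
      simp [diffSign, hai, haj]
  apply bilin_ext_xy <;> intro a b <;> rw [reflForm_apply]
  · rw [hψ.form_xx hg]; simp
  · rw [hxy]; simp
  · rw [hskew, hxy]
    simp only [xDiff_yVec, yDiff_yVec, xDiff_xVec, yDiff_xVec]
    ring
  · rw [hψ.form_yy hg]; simp

/-- The invariant constant cochains with `ψ(κ)_g = 0` for all `g ≠ 1`. -/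
theorem exists_eq_kappaC (hn : 3 ≤ n) {κ : TwoCochain (Equiv.Perm (Fin n)) (DoubledSpace n) ℂ}
    (hinv : IsInvariantConst (doubledPermRep n) κ)
    (hψ : ∀ g, g ≠ 1 → ∀ u v w, psiConst (doubledPermRep n) κ g u v w = 0) :
    ∃ α β c : ℂ, κ = kappaCOne n α β + kappaCRefl n c := by
  obtain ⟨x, y, -, hxy, -, -⟩ := exists_three_distinct hn
  obtain ⟨α, β, h1⟩ := exists_pairing_of_invariant hn (toBilin_swap (κ 1)) fun σ v w => by
    have := hinv 1 σ v w
    rw [mul_one, mul_inv_cancel] at this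
    exact this.symm
  -- The scalar `c` is read off at one transposition; conjugation carries it to all others.
  refine ⟨α, β, κ (Equiv.swap x y) ![xVec x, yVec x], funext fun g => ?_⟩
  apply toBilin_injective
  by_cases hg : g = 1
  · subst hg
    rw [kappaC_one, toBilin_kappaCOne, h1]
  rw [kappaC_of_ne_one _ _ _ hg]
  have hψg : PsiVanishes g (toBilin (κ g)) := hψ g hg
  by_cases hs : g.IsSwap
  · obtain ⟨i, j, hij, rfl⟩ := hs
    obtain ⟨σ, rfl, rfl⟩ := exists_perm_two hxy hij
    have hc := hinv (Equiv.swap x y) σ (xVec x) (yVec x)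
    rw [conj_swap, doubledPermRep_xVec, doubledPermRep_yVec] at hc
    rw [toBilin_kappaCRefl_swap _ hij, hc, ← toBilin_apply]
    exact hψg.form_eq_reflForm hij (toBilin_swap _)
  · rw [kappaCRefl_of_not_isSwap _ hs, toBilin_zero]
    exact hψg.form_eq_zero hg (toBilin_swap _) hs

end Support

/-! ### Classification and the simplified conditions (IV) -/

section Classification

variable {n : ℕ}

/-- Every Lie orbifold algebra map is of the form `κ^L_1 + κ^C_1 + κ^C_ref`. -/
theorem IsLieOrbifoldAlgebraMap.exists_params (hn : 3 ≤ n)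
    {κL : TwoCochain (Equiv.Perm (Fin n)) (DoubledSpace n) (DoubledSpace n)}
    {κC : TwoCochain (Equiv.Perm (Fin n)) (DoubledSpace n) ℂ}
    (h : IsLieOrbifoldAlgebraMap (doubledPermRep n) κL κC) :
    ∃ p : Params, κL = kappaLOne n p ∧ κC = kappaCOne n p.α p.β + kappaCRefl n p.c := by
  obtain ⟨hs, hL, hC, hψ, -, -⟩ := (isLieOrbifoldAlgebraMap_iff _ _ _).mp h
  obtain ⟨α, β, c, hκC⟩ := exists_eq_kappaC hn hC hψ
  obtain ⟨p, rfl, rfl, rfl, hp⟩ := exists_params_of_equivariant hn (toBilin_swap (κL 1))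
    (fun σ v w => by
      have := hL 1 σ v w
      rwa [mul_one, mul_inv_cancel] at this) α β c
  refine ⟨p, funext fun g => ?_, hκC⟩
  by_cases hg : g = 1
  · subst hg
    exact toBilin_injective (hp.trans (toBilin_kappaLOne p).symm)
  · rw [hs g hg, kappaLOne, if_neg hg]

/-- Cancelling `c` turns (III) into four linear relations, which eliminate one parameter each. After
substitution, the sixteen conditions (I) coincide up to sign in groups: the 1st, 4th, 7th and 16th;
the 2nd and 10th; the 3rd and 13th; the 6th and 15th. Ten remain, and in (II) the factor `α + (n -
1) * β` splits off. -/
theorem lieOrbifoldConditions_iff_simplified {p : Params} (hc : p.c ≠ 0) :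
    LieOrbifoldConditions n p ↔ SimplifiedConditions n p := by
  obtain ⟨a₁, a₂, a₃, a₄, a₅, a₆, a₇, b₁, b₂, b₃, b₄, b₅, b₆, b₇, α, β, c⟩ := p
  have hlin : SecondObstructionConditionsRefl
      ⟨a₁, a₂, a₃, a₄, a₅, a₆, a₇, b₁, b₂, b₃, b₄, b₅, b₆, b₇, α, β, c⟩ ↔
      a₁ = b₆ ∧ a₁ - b₃ + b₅ = 0 ∧ b₂ = -a₅ ∧ b₂ + a₃ - a₆ = 0 := by
    simp only [SecondObstructionConditionsRefl, mul_eq_zero, or_iff_right hc]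
    constructor
    · rintro ⟨h1, h2, h3, h4⟩
      exact ⟨by linear_combination h1, by linear_combination h2 - h1,
        by linear_combination h3, by linear_combination h4 - h3⟩
    · rintro ⟨h1, h2, h3, h4⟩
      exact ⟨by linear_combination h1, by linear_combination h2 + h1,
        by linear_combination h3, by linear_combination h4 + h3⟩
  rw [LieOrbifoldConditions, hlin]
  simp only [FirstObstructionConditions, SecondObstructionConditionsOne, SimplifiedConditions]
  constructor
  · rintro ⟨⟨e0, e1, e2, e3, e4, e5, e6, e7, e8, e9, e10, e11, e12, e13, e14, e15⟩, ⟨f0, f1⟩,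
      l1, l2, l3, l4⟩
    obtain rfl : b₆ = a₁ := l1.symm
    obtain rfl : b₃ = b₆ + b₅ := by linear_combination -l2
    obtain rfl : a₆ = b₂ + a₃ := by linear_combination -l4
    obtain rfl : b₂ = -a₅ := l3
    refine ⟨⟨rfl, l2, rfl, l4⟩, ⟨?_, ?_, ?_, ?_, ?_, ?_, ?_, ?_, ?_, ?_⟩, ?_, ?_⟩
    · linear_combination -e4
    · linear_combination -e7
    · linear_combination e10
    · linear_combination e13
    · linear_combination e5
    · linear_combination e0
    · linear_combination e8
    · linear_combination e1
    · linear_combination e11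
    · linear_combination e2
    · linear_combination f0
    · linear_combination f1
  · rintro ⟨⟨l1, l2, l3, l4⟩, ⟨s0, s1, s2, s3, s4, s5, s6, s7, s8, s9⟩, s10, s11⟩
    obtain rfl : b₆ = a₁ := l1.symm
    obtain rfl : b₃ = b₆ + b₅ := by linear_combination -l2
    obtain rfl : a₆ = b₂ + a₃ := by linear_combination -l4
    obtain rfl : b₂ = -a₅ := l3
    refine ⟨⟨?_, ?_, ?_, ?_, ?_, ?_, ?_, ?_, ?_, ?_, ?_, ?_, ?_, ?_, ?_, ?_⟩, ⟨?_, ?_⟩,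
      rfl, l2, rfl, l4⟩
    · linear_combination s5
    · linear_combination s7
    · linear_combination s9
    · linear_combination s5
    · linear_combination -s0
    · linear_combination s4
    · linear_combination -s5
    · linear_combination -s1
    · linear_combination s6
    · linear_combination s7
    · linear_combination s2
    · linear_combination s8
    · linear_combination -s9
    · linear_combination s3
    · linear_combination s4
    · linear_combination -s5
    · linear_combination s10
    · linear_combination s11

end Classification

end DrinfeldOrbifold

end

theorem mainTheorem3 (n : ℕ) (hn : 4 ≤ n) :
    -- the Lie orbifold algebra maps are precisely the maps of the stated form
    (∀ (κL : DrinfeldOrbifold.TwoCochain (Equiv.Perm (Fin n))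
          (DrinfeldOrbifold.DoubledSpace n) (DrinfeldOrbifold.DoubledSpace n))
        (κC : DrinfeldOrbifold.TwoCochain (Equiv.Perm (Fin n))
          (DrinfeldOrbifold.DoubledSpace n) ℂ),
      DrinfeldOrbifold.IsLieOrbifoldAlgebraMap (DrinfeldOrbifold.doubledPermRep n) κL κC ↔
        ∃ p : DrinfeldOrbifold.Params,
          κL = DrinfeldOrbifold.kappaLOne n p ∧
          κC = DrinfeldOrbifold.kappaCOne n p.α p.β + DrinfeldOrbifold.kappaCRefl n p.c ∧
          DrinfeldOrbifold.LieOrbifoldConditions n p) ∧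
    -- a given choice of the parameters yields such a map if and only if it satisfies the conditions
    (∀ p : DrinfeldOrbifold.Params,
      DrinfeldOrbifold.IsLieOrbifoldAlgebraMap (DrinfeldOrbifold.doubledPermRep n)
          (DrinfeldOrbifold.kappaLOne n p)
          (DrinfeldOrbifold.kappaCOne n p.α p.β + DrinfeldOrbifold.kappaCRefl n p.c) ↔
        DrinfeldOrbifold.LieOrbifoldConditions n p) ∧
    -- the special case without reflection part
    (∀ p : DrinfeldOrbifold.Params,
      DrinfeldOrbifold.IsLieOrbifoldAlgebraMap (DrinfeldOrbifold.doubledPermRep n)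
          (DrinfeldOrbifold.kappaLOne n p) (DrinfeldOrbifold.kappaCOne n p.α p.β) ↔
        DrinfeldOrbifold.FirstObstructionConditions n p ∧
          DrinfeldOrbifold.SecondObstructionConditionsOne n p) ∧
    -- the special case of a nonzero reflection part
    (∀ p : DrinfeldOrbifold.Params, DrinfeldOrbifold.kappaCRefl n p.c ≠ 0 →
      (DrinfeldOrbifold.IsLieOrbifoldAlgebraMap (DrinfeldOrbifold.doubledPermRep n)
          (DrinfeldOrbifold.kappaLOne n p)
          (DrinfeldOrbifold.kappaCOne n p.α p.β + DrinfeldOrbifold.kappaCRefl n p.c) ↔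
        DrinfeldOrbifold.SimplifiedConditions n p)) := by
  have hn' : 3 ≤ n := le_of_lt hn
  refine ⟨fun κL κC => ⟨fun h => ?_, ?_⟩, DrinfeldOrbifold.isLieOrbifoldAlgebraMap_kappa_iff hn',
    fun p => ?_, fun p hp => ?_⟩
  · obtain ⟨p, rfl, rfl⟩ := h.exists_params hn'
    exact ⟨p, rfl, rfl, (DrinfeldOrbifold.isLieOrbifoldAlgebraMap_kappa_iff hn' p).mp h⟩
  · rintro ⟨p, rfl, rfl, h⟩
    exact (DrinfeldOrbifold.isLieOrbifoldAlgebraMap_kappa_iff hn' p).mpr h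
  -- Conditions (I) and (II) do not involve `c`; setting it to zero removes the reflection part and
  -- makes (III) trivial.
  · have h := DrinfeldOrbifold.isLieOrbifoldAlgebraMap_kappa_iff hn' { p with c := 0 }
    simp only [DrinfeldOrbifold.kappaCRefl_zero, add_zero] at h
    refine Iff.trans h ⟨fun h => ⟨h.1, h.2.1⟩, fun h => ⟨h.1, h.2, ?_⟩⟩
    simp [DrinfeldOrbifold.SecondObstructionConditionsRefl]
  · have hc : p.c ≠ 0 := by
      rintro h
      rw [h, DrinfeldOrbifold.kappaCRefl_zero] at hp
      exact hp rfl
    rw [DrinfeldOrbifold.isLieOrbifoldAlgebraMap_kappa_iff hn', DrinfeldOrbifold.lieOrbifoldConditions_iff_simplified hc]
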